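/- Let $\mathbb{K}$ be a field of characteristic zero and let $\ell\ge 2$. Let $\mathrm{Shi}_\ell$ be the central hyperplane arrangement in $\mathbb{K}^{\ell+1}$, with coordinates $z,x_1,\dots,x_\ell$ and $S=\mathbb{K}[z,x_1,\dots,x_\ell]$, defined by $$Q=z\prod_{i=1}^{\ell}x_i(x_i-z)\prod_{1\le i<j\le \ell}(x_i-x_j)(x_i-x_j-z).$$ For $m\ge 1$ let $D^{(m)}(S)=\bigoplus_{|\boldsymbol a|=m}S\,\partial^{\boldsymbol a}\subseteq \mathrm{End}_{\mathbb{K}}(S)$, where $\boldsymbol a\in\mathbb{N}^{\ell+1}$ runs over the multi-indices of total degree $m$ and $\partial^{\boldsymbol a}$ is the corresponding product of partial derivatives, and let $$D^{(m)}(\mathrm{Shi}_\ell)=\{\theta\in D^{(m)}(S)\mid \theta(QS)\subseteq QS\}.$$ An arrangement is called $m$-free if this module, formed with a defining polynomial of the arrangement (a product of linear forms, one for each of its hyperplanes, with that hyperplane as kernel), is a free $S$-module. Then $\mathrm{Shi}_\ell$ is not $2$-free; that is, $D^{(2)}(\mathrm{Shi}_\ell)$ is not a free $S$-module. -/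

import Mathlib

noncomputable section

open MvPolynomial

namespace HypArr

/-- A central hyperplane arrangement in `K ^ n`: a finite collection of linear hyperplanes
(linear subspaces of codimension one). -/
structure Arrangement (K : Type*) [Field K] (n : ℕ) where
  hyperplanes : Finset (Submodule K (Fin n → K))
  isCoatom : ∀ H ∈ hyperplanes, IsCoatom H

section Polynomials

variable {K : Type*} [Field K] {n : ℕ}

/-- A linear form on `K ^ n` as a homogeneous polynomial of degree one:
`α` is sent to `∑ i, α(e_i) x_i`. -/
def formPoly (α : Module.Dual K (Fin n → K)) : MvPolynomial (Fin n) K :=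
  ∑ i, C (α (Pi.single i 1)) * X i

/-- Every linear hyperplane is the kernel of a linear form. -/
theorem exists_form {H : Submodule K (Fin n → K)} (hH : IsCoatom H) :
    ∃ α : Module.Dual K (Fin n → K), LinearMap.ker α = H := by
  obtain ⟨α, hα, hle⟩ := H.exists_le_ker_of_lt_top (lt_top_iff_ne_top.2 hH.1)
  refine ⟨α, ?_⟩
  rcases hH.le_iff.1 hle with h | h
  · exact absurd (LinearMap.ker_eq_top.1 h) hα
  · exact h

/-- The differential operator `∂ ^ a = ∂_1 ^ a_1 ⋯ ∂_n ^ a_n` on the polynomial ring. -/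
def partialPow (K : Type*) [Field K] {n : ℕ} (a : Fin n → ℕ) :
    Module.End K (MvPolynomial (Fin n) K) :=
  (List.ofFn fun i => (pderiv (R := K) i).toLinearMap ^ a i).prod

/-- `D^(m)(S)`: the `S`-submodule of `End_K(S)` generated by the `∂ ^ a` with `|a| = m`, where
`S = K[x_1, …, x_n]` acts on `End_K(S)` by `(f • θ)(g) = f * θ(g)`. -/
def homogOps (K : Type*) [Field K] (n m : ℕ) :
    Submodule (MvPolynomial (Fin n) K) (Module.End K (MvPolynomial (Fin n) K)) :=
  Submodule.span _ {θ | ∃ a : Fin n → ℕ, ∑ i, a i = m ∧ θ = partialPow K a}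

/-- The operators `θ ∈ D^(m)(S)` with `θ(Q S) ⊆ Q S`. -/
def opsPreserving (m : ℕ) (Q : MvPolynomial (Fin n) K) :
    Submodule (MvPolynomial (Fin n) K) (Module.End K (MvPolynomial (Fin n) K)) where
  carrier := {θ | θ ∈ homogOps K n m ∧
    ∀ g ∈ Ideal.span {Q}, θ g ∈ Ideal.span {Q}}
  add_mem' := fun ha hb =>
    ⟨add_mem ha.1 hb.1, fun g hg => Ideal.add_mem _ (ha.2 g hg) (hb.2 g hg)⟩
  zero_mem' := ⟨zero_mem _, fun _ _ => Ideal.zero_mem _⟩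
  smul_mem' := fun f _ hθ =>
    ⟨Submodule.smul_mem _ f hθ.1, fun g hg => Ideal.mul_mem_left _ f (hθ.2 g hg)⟩

end Polynomials

namespace Arrangement

variable {K : Type*} [Field K] {n : ℕ}

/-- A linear form `α_H` with kernel `H`, for each hyperplane `H` of the arrangement. -/
def form (A : Arrangement K n) (H : A.hyperplanes) : Module.Dual K (Fin n → K) :=
  (exists_form (A.isCoatom H.1 H.2)).choose

/-- The defining polynomial `Q(A) = ∏_{H ∈ A} α_H`, determined by `A` up to a nonzero scalar. -/
def definingPoly (A : Arrangement K n) : MvPolynomial (Fin n) K :=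
  ∏ H : A.hyperplanes, formPoly (A.form H)

/-- The module `D^(m)(A)` of `m`th order `A`-differential operators. -/
def diffOps (A : Arrangement K n) (m : ℕ) :
    Submodule (MvPolynomial (Fin n) K) (Module.End K (MvPolynomial (Fin n) K)) :=
  opsPreserving m A.definingPoly

/-- `A` is `m`-free if `D^(m)(A)` is a free `S`-module. -/
def IsMFree (A : Arrangement K n) (m : ℕ) : Prop :=
  Module.Free (MvPolynomial (Fin n) K) (A.diffOps m)

end Arrangement

/-- Index set of the hyperplanes of the Shi arrangement: one for `z`, one for each `x_i`, one for
each `x_i - z`, and, for each pair `i < j`, one for `x_i - x_j` and one for `x_i - x_j - z`. -/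
abbrev ShiIndex (ℓ : ℕ) : Type :=
  Unit ⊕ Fin ℓ ⊕ Fin ℓ ⊕
    {p : Fin ℓ × Fin ℓ // p.1 < p.2} ⊕ {p : Fin ℓ × Fin ℓ // p.1 < p.2}

/-- The linear forms of the Shi arrangement on `K ^ (ℓ + 1)`. The coordinate of index `0` is `z`
and the coordinates of index `1, …, ℓ` are `x_1, …, x_ℓ`. -/
def shiForm (K : Type*) [Field K] (ℓ : ℕ) :
    ShiIndex ℓ → Module.Dual K (Fin (ℓ + 1) → K) :=
  let z : Module.Dual K (Fin (ℓ + 1) → K) := LinearMap.proj 0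
  let x : Fin ℓ → Module.Dual K (Fin (ℓ + 1) → K) := fun i => LinearMap.proj i.succ
  Sum.elim (fun _ => z) <|
    Sum.elim (fun i => x i) <|
      Sum.elim (fun i => x i - z) <|
        Sum.elim (fun p => x p.1.1 - x p.1.2) (fun p => x p.1.1 - x p.1.2 - z)

theorem shiForm_ne_zero (K : Type*) [Field K] (ℓ : ℕ) (s : ShiIndex ℓ) :
    shiForm K ℓ s ≠ 0 := by
  intro h
  have h' : ∀ k, shiForm K ℓ s (Pi.single k 1) = 0 := fun k => by rw [h]; rfl
  rcases s with s | i | i | ⟨⟨i, j⟩, hij⟩ | ⟨⟨i, j⟩, hij⟩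
  · simpa [shiForm] using h' 0
  · simpa [shiForm] using h' i.succ
  · simpa [shiForm, Pi.single_apply, (Fin.succ_ne_zero _).symm] using h' i.succ
  · simpa [shiForm, Pi.single_apply, (show i < j from hij).ne'] using h' i.succ
  · simpa [shiForm, Pi.single_apply, (show i < j from hij).ne', (Fin.succ_ne_zero _).symm]
      using h' i.succ

open Classical in
/-- The Shi arrangement `Shi_ℓ`, an arrangement in `K ^ (ℓ + 1)`. -/
def shi (K : Type*) [Field K] (ℓ : ℕ) : Arrangement K (ℓ + 1) where
  hyperplanes := Finset.univ.image fun s => LinearMap.ker (shiForm K ℓ s)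
  isCoatom := by
    intro H hH
    obtain ⟨s, -, rfl⟩ := Finset.mem_image.1 hH
    exact LinearMap.isCoatom_ker_of_surjective (LinearMap.surjective (shiForm_ne_zero K ℓ s))

/-- The explicit defining polynomial
`z ∏_i x_i (x_i - z) ∏_{i < j} (x_i - x_j) (x_i - x_j - z)`. -/
def shiPoly (K : Type*) [Field K] (ℓ : ℕ) : MvPolynomial (Fin (ℓ + 1)) K :=
  X 0 * (∏ i : Fin ℓ, X i.succ * (X i.succ - X 0)) *
    ∏ p : {p : Fin ℓ × Fin ℓ // p.1 < p.2},
      (X p.1.1.succ - X p.1.2.succ) * (X p.1.1.succ - X p.1.2.succ - X 0)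

theorem eq_smul_of_ker_eq {K : Type*} [Field K] {n : ℕ} {f g : Module.Dual K (Fin n → K)}
    (h : LinearMap.ker f = LinearMap.ker g) : ∃ c : K, g = c • f := by
  have := mem_span_of_iInf_ker_le_ker (ι := Unit) (L := fun _ => f) (K := g) (by simp [h])
  simp only [Set.range_const, Submodule.mem_span_singleton] at this
  obtain ⟨c, hc⟩ := this
  exact ⟨c, hc.symm⟩

theorem shiForm_ker_injective (K : Type*) [Field K] [CharZero K] (ℓ : ℕ) :
    Function.Injective fun s => LinearMap.ker (shiForm K ℓ s) := by
  intro s t h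
  obtain ⟨c, hc⟩ := eq_smul_of_ker_eq h
  have h' : ∀ k, shiForm K ℓ t (Pi.single k 1) = c * shiForm K ℓ s (Pi.single k 1) :=
    fun k => by rw [hc]; rfl
  have h0 := h' 0
  have h1 := fun i : Fin ℓ => h' i.succ
  have two : (1 : K) ≠ -1 := by norm_num
  rcases s with s | i | i | ⟨⟨i, j⟩, hij⟩ | ⟨⟨i, j⟩, hij⟩ <;>
  rcases t with t | i' | i' | ⟨⟨i', j'⟩, hij'⟩ | ⟨⟨i', j'⟩, hij'⟩ <;>
  simp only [shiForm, Sum.elim_inl, Sum.elim_inr, LinearMap.sub_apply, LinearMap.proj_apply,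
    Pi.single_apply, Fin.succ_inj, Fin.succ_ne_zero, (Fin.succ_ne_zero _).symm, if_true, if_false]
    at h0 h1 <;>
  (try have a1 := h1 i) <;> (try have a2 := h1 j) <;>
  (try have a3 := h1 i') <;> (try have a4 := h1 j') <;>
  clear h h' hc h1 <;>
  grind

theorem formPoly_sub {K : Type*} [Field K] {n : ℕ} (f g : Module.Dual K (Fin n → K)) :
    formPoly (f - g) = formPoly f - formPoly g := by
  simp [formPoly, sub_mul, Finset.sum_sub_distrib]

theorem formPoly_smul {K : Type*} [Field K] {n : ℕ} (c : K) (f : Module.Dual K (Fin n → K)) :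
    formPoly (c • f) = C c * formPoly f := by
  simp [formPoly, Finset.mul_sum, mul_assoc]

theorem formPoly_proj {K : Type*} [Field K] {n : ℕ} (i : Fin n) :
    formPoly (LinearMap.proj i : Module.Dual K (Fin n → K)) = X i := by
  rw [formPoly, Finset.sum_eq_single i] <;> simp +contextual [eq_comm]

theorem prod_formPoly_shiForm (K : Type*) [Field K] (ℓ : ℕ) :
    ∏ s, formPoly (shiForm K ℓ s) = shiPoly K ℓ := by
  simp only [Fintype.prod_sum_type, shiForm, Sum.elim_inl, Sum.elim_inr, formPoly_sub,
    formPoly_proj, shiPoly, Finset.prod_mul_distrib, Finset.univ_unique, Finset.prod_singleton]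
  ring

/-- `Shi_ℓ` is the arrangement defined by `shiPoly`. -/
theorem associated_definingPoly_shi (K : Type*) [Field K] [CharZero K] (ℓ : ℕ) :
    Associated (shi K ℓ).definingPoly (shiPoly K ℓ) := by
  classical
  let e : ShiIndex ℓ → (shi K ℓ).hyperplanes := fun s =>
    ⟨LinearMap.ker (shiForm K ℓ s), by simp [shi]⟩
  have he : Function.Bijective e := by
    refine ⟨fun s t h => shiForm_ker_injective K ℓ (congrArg Subtype.val h), fun H => ?_⟩
    obtain ⟨H, hH⟩ := H
    obtain ⟨s, -, hs⟩ := Finset.mem_image.1 hH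
    exact ⟨s, Subtype.ext hs⟩
  rw [Arrangement.definingPoly, ← prod_formPoly_shiForm, ← he.prod_comp]
  refine Associated.prod _ _ _ fun s _ => ?_
  have hk : LinearMap.ker ((shi K ℓ).form (e s)) = LinearMap.ker (shiForm K ℓ s) :=
    (exists_form ((shi K ℓ).isCoatom (e s).1 (e s).2)).choose_spec
  obtain ⟨c, hc⟩ := eq_smul_of_ker_eq hk
  have hc0 : c ≠ 0 := by
    rintro rfl
    exact shiForm_ne_zero K ℓ s (by simpa using hc)
  rw [hc, formPoly_smul]
  exact (associated_unit_mul_left _ _ ((isUnit_iff_ne_zero.2 hc0).map C)).symm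

theorem diffOps_shi (K : Type*) [Field K] [CharZero K] (ℓ m : ℕ) :
    (shi K ℓ).diffOps m = opsPreserving m (shiPoly K ℓ) := by
  have h : Ideal.span {(shi K ℓ).definingPoly} = Ideal.span {shiPoly K ℓ} :=
    Ideal.span_singleton_eq_span_singleton.2 (associated_definingPoly_shi K ℓ)
  ext θ
  simp only [Arrangement.diffOps, opsPreserving, h]

end HypArr

end

noncomputable section

open MvPolynomial

namespace HypArr

/-! ### Second order operators as symmetric matrices -/

section Operators

variable {K : Type*} [Field K] {n : ℕ}

/-! Write n = ℓ + 1. A second order operator θ is the same thing as the symmetric matrix F_ij =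
θ(x_i x_j), and preserving QS forces α ∣ ∑ a_i F_ij for every j and every form α = ∑ a_i x_i of the
arrangement. Freeness is refuted by two incompatible facts about the determinant of a basis of such
matrices, viewed as vectors of length N = n(n+1)/2.

Upper bound (`exists_rows_det_dvd_pow`): as in Saito's criterion, the determinant of a basis divides
that of any N-tuple in the module. For each α there is a tuple with determinant α^n (Q/α)^N up to a
unit; combining these over all α, the determinant of the basis divides Q^n.

Lower bound (`X_pow_dvd_toLine_det`): take a point of the flat z = x_1 = x_2 = 0 lying on exactly
the seven hyperplanes of Shi_2, and a line with parameter t through it, transversal to all seven.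
There Q^n has order exactly 7n. After a shear sending the Euler direction to a coordinate vector, a
column F_{·k} with k ≥ 3 has orders 1, 3, 3 in the first three entries (the exponents of Shi_2, with
sum 7). For the 3 × 3 block, symmetry raises the orders to 2 for the Euler entry and 4 for the other
five (`ShiDvd.map_dvd_of_symm`): 22 in total, one more than 3 · 7. So the determinant has order at
least 7(n - 3) + 22 = 7n + 1, a contradiction. -/

theorem pderiv_pderiv_comm (i j : Fin n) (f : MvPolynomial (Fin n) K) :
    pderiv i (pderiv j f) = pderiv j (pderiv i f) := by
  have h : ⁅pderiv (R := K) i, pderiv (R := K) j⁆ = 0 := by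
    refine MvPolynomial.derivation_ext fun k => ?_
    rw [Derivation.commutator_apply]
    simp only [pderiv_X, Pi.single_apply]
    split_ifs <;> simp
  have := congrArg (fun D => D f) h
  simpa [Derivation.commutator_apply, sub_eq_zero] using this

theorem commute_pderiv (i j : Fin n) :
    (pderiv (R := K) i).toLinearMap * (pderiv (R := K) j).toLinearMap =
      (pderiv (R := K) j).toLinearMap * (pderiv (R := K) i).toLinearMap :=
  LinearMap.ext fun f => pderiv_pderiv_comm i j f

/-- `∂_i ∂_j` as an operator. -/
def pderivTwo (K : Type*) [Field K] {n : ℕ} (i j : Fin n) :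
    Module.End K (MvPolynomial (Fin n) K) :=
  (pderiv (R := K) i).toLinearMap * (pderiv (R := K) j).toLinearMap

theorem pderivTwo_apply (i j : Fin n) (f : MvPolynomial (Fin n) K) :
    pderivTwo K i j f = pderiv i (pderiv j f) := rfl

theorem partialPow_single_add_single (i j : Fin n) :
    partialPow K (Pi.single i 1 + Pi.single j 1) = pderivTwo K i j := by
  classical
  -- `partialPow` is an ordered product in a noncommutative ring; inside the commutative submonoid
  -- generated by the partials it becomes a `Finset` product, where exponents can be added.
  let T : Set (Module.End K (MvPolynomial (Fin n) K)) :=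
    Set.range fun i => (pderiv (R := K) i).toLinearMap
  have hT : ∀ a ∈ T, ∀ b ∈ T, a * b = b * a := by
    rintro _ ⟨i, rfl⟩ _ ⟨j, rfl⟩
    exact commute_pderiv i j
  have := Submonoid.isMulCommutative_closure _ hT
  let _ : CommMonoid (Submonoid.closure T) := { mul_comm := fun a b => this.is_comm.comm a b }
  let y : Fin n → Submonoid.closure T := fun i => ⟨_, Submonoid.subset_closure ⟨i, rfl⟩⟩
  have key : ∀ a : Fin n → ℕ, partialPow K a = ((∏ i, y i ^ a i : Submonoid.closure T) :
      Module.End K (MvPolynomial (Fin n) K)) := by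
    intro a
    rw [← List.prod_ofFn]
    rw [partialPow]
    have : (List.ofFn fun i => (pderiv (R := K) i).toLinearMap ^ a i) =
        (List.ofFn fun i => y i ^ a i).map (Submonoid.closure T).subtype := by
      rw [List.map_ofFn]; rfl
    rw [this]
    exact ((Submonoid.closure T).subtype.map_list_prod _).symm
  rw [key]
  simp only [Pi.add_apply, pow_add, Finset.prod_mul_distrib]
  simp [Pi.single_apply, pow_ite, y, pderivTwo]

theorem exists_eq_single_add_single (a : Fin n → ℕ) (ha : ∑ i, a i = 2) :
    ∃ i j, a = Pi.single i 1 + Pi.single j 1 := by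
  have pos : ∀ b : Fin n → ℕ, ∑ i, b i ≠ 0 → ∃ i, b i ≠ 0 := by
    intro b hb
    by_contra! h
    exact hb (by simp [h])
  have step : ∀ (b : Fin n → ℕ) i, b i ≠ 0 → b = (b - Pi.single i 1) + Pi.single i 1 := by
    intro b i hi
    funext k
    by_cases hk : k = i
    · subst hk; simp; omega
    · simp [hk]
  have hsum : ∀ (b : Fin n → ℕ) (i), ∑ k, (b + Pi.single i 1 : Fin n → ℕ) k = ∑ k, b k + 1 := by
    intro b i
    simp [Finset.sum_add_distrib]
  obtain ⟨i, hi⟩ := pos a (by omega)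
  set b := a - Pi.single i 1 with hb
  have hab := step a i hi
  rw [← hb] at hab
  have hbs : ∑ k, b k = 1 := by
    have := hsum b i
    rw [← hab] at this; omega
  obtain ⟨j, hj⟩ := pos b (by omega)
  set c := b - Pi.single j 1 with hc
  have hbc := step b j hj
  rw [← hc] at hbc
  have hcs : ∑ k, c k = 0 := by
    have := hsum c j
    rw [← hbc] at this; omega
  have hc0 : c = 0 := by
    funext k
    exact Finset.sum_eq_zero_iff.1 hcs k (Finset.mem_univ _)
  refine ⟨j, i, ?_⟩
  rw [hab, hbc, hc0, zero_add]

/-- The coordinates `θ(x_i x_j)` of a second order operator. -/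
def symCoord (K : Type*) [Field K] (n : ℕ) :
    Module.End K (MvPolynomial (Fin n) K) →ₗ[MvPolynomial (Fin n) K]
      (Sym2 (Fin n) → MvPolynomial (Fin n) K) where
  toFun θ := fun e => θ (e.map X).mul
  map_add' _ _ := rfl
  map_smul' _ _ := rfl

theorem symCoord_mk (θ : Module.End K (MvPolynomial (Fin n) K)) (i j : Fin n) :
    symCoord K n θ s(i, j) = θ (X i * X j) := rfl

/-- The operator `½ ∑ F_ij ∂_i ∂_j`. -/
def symOp (F : Sym2 (Fin n) → MvPolynomial (Fin n) K) :
    Module.End K (MvPolynomial (Fin n) K) :=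
  ∑ i, ∑ j, (C (2⁻¹ : K) * F s(i, j)) • pderivTwo K i j

theorem symOp_apply (F : Sym2 (Fin n) → MvPolynomial (Fin n) K) (f : MvPolynomial (Fin n) K) :
    symOp F f = ∑ i, ∑ j, C (2⁻¹ : K) * F s(i, j) * pderiv i (pderiv j f) := by
  simp [symOp, LinearMap.sum_apply, pderivTwo_apply]

theorem symOp_mem_homogOps (F : Sym2 (Fin n) → MvPolynomial (Fin n) K) :
    symOp F ∈ homogOps K n 2 := by
  refine Submodule.sum_mem _ fun i _ => Submodule.sum_mem _ fun j _ => Submodule.smul_mem _ _ ?_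
  refine Submodule.subset_span ⟨Pi.single i 1 + Pi.single j 1, ?_,
    (partialPow_single_add_single i j).symm⟩
  simp [Finset.sum_add_distrib]

theorem pderiv_pderiv_mul (a b : Fin n) (f g : MvPolynomial (Fin n) K) :
    pderiv a (pderiv b (f * g)) = pderiv a (pderiv b f) * g + pderiv b f * pderiv a g
      + pderiv a f * pderiv b g + f * pderiv a (pderiv b g) := by
  simp only [pderiv_mul, map_add]; ring

theorem symOp_X (F : Sym2 (Fin n) → MvPolynomial (Fin n) K) (i : Fin n) :
    symOp F (X i) = 0 := by
  simp only [symOp_apply, pderiv_X, Pi.single_apply]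
  refine Finset.sum_eq_zero fun a _ => Finset.sum_eq_zero fun b _ => ?_
  split_ifs <;> simp

variable [CharZero K]

theorem C_inv_two : (C (2⁻¹ : K) : MvPolynomial (Fin n) K) * 2 = 1 := by
  have : (2 : MvPolynomial (Fin n) K) = C 2 := (map_ofNat C 2).symm
  rw [this, ← C_mul]; simp

/-- Leibniz rule for second order operators. -/
theorem symOp_mul (F : Sym2 (Fin n) → MvPolynomial (Fin n) K) (f g : MvPolynomial (Fin n) K) :
    symOp F (f * g) = symOp F f * g + f * symOp F g +
      ∑ i, ∑ j, F s(i, j) * pderiv i f * pderiv j g := by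
  have h : ∑ i, ∑ j, F s(i, j) * pderiv i f * pderiv j g =
      ∑ i, ∑ j, C (2⁻¹ : K) * F s(i, j) *
        (pderiv i f * pderiv j g + pderiv j f * pderiv i g) := by
    simp only [mul_add, Finset.sum_add_distrib]
    rw [Finset.sum_comm (f := fun i j => C (2⁻¹ : K) * F s(i, j) * (pderiv j f * pderiv i g)),
      ← Finset.sum_add_distrib]
    refine Finset.sum_congr rfl fun i _ => ?_
    rw [← Finset.sum_add_distrib]
    refine Finset.sum_congr rfl fun j _ => ?_
    rw [Sym2.eq_swap (a := j)]
    linear_combination (-F s(i, j) * pderiv i f * pderiv j g) * C_inv_two (K := K) (n := n)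
  rw [h]
  simp only [symOp_apply, Finset.sum_mul, Finset.mul_sum, ← Finset.sum_add_distrib]
  refine Finset.sum_congr rfl fun i _ => Finset.sum_congr rfl fun j _ => ?_
  rw [pderiv_pderiv_mul]; ring

theorem symCoord_symOp (F : Sym2 (Fin n) → MvPolynomial (Fin n) K) :
    symCoord K n (symOp F) = F := by
  funext e
  induction e with | _ i j
  rw [symCoord_mk, symOp_mul, symOp_X, symOp_X]
  simp [pderiv_X, Pi.single_apply]

theorem symOp_symCoord {θ : Module.End K (MvPolynomial (Fin n) K)} (hθ : θ ∈ homogOps K n 2) :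
    symOp (symCoord K n θ) = θ := by
  induction hθ using Submodule.span_induction with
  | mem θ h =>
    obtain ⟨a, ha, rfl⟩ := h
    obtain ⟨i, j, rfl⟩ := exists_eq_single_add_single a ha
    rw [partialPow_single_add_single]
    refine LinearMap.ext fun f => ?_
    have : ∀ a b, symCoord K n (pderivTwo K i j) s(a, b) =
        (if a = i then if b = j then 1 else 0 else 0) +
        (if a = j then if b = i then 1 else 0 else 0) := by
      intro a b
      rw [symCoord_mk, pderivTwo_apply]
      simp only [pderiv_mul, pderiv_X, Pi.single_apply, map_add]
      split_ifs <;> simp_all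
    simp only [symOp_apply, this, mul_add, add_mul, Finset.sum_add_distrib]
    simp only [ite_mul, mul_ite, mul_one, mul_zero, zero_mul, Finset.sum_ite_eq', Finset.mem_univ, if_true, Finset.sum_ite_irrel, Finset.sum_const_zero]
    rw [pderiv_pderiv_comm j i, ← two_mul, pderivTwo_apply]
    linear_combination (pderiv i (pderiv j f)) * C_inv_two (K := K) (n := n)
  | zero => simp [symOp]
  | add x y _ _ hx hy =>
    conv_rhs => rw [← hx, ← hy]
    simp [symOp, mul_add, add_smul, Finset.sum_add_distrib]
  | smul g x _ hx =>
    conv_rhs => rw [← hx]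
    simp [symOp, Finset.smul_sum, smul_smul, mul_left_comm]

/-- On the span of the ∂^a of order exactly two, no lower order terms are present, so the values on
quadratic monomials determine the operator. -/
theorem symCoord_injOn {θ : Module.End K (MvPolynomial (Fin n) K)} (hθ : θ ∈ homogOps K n 2)
    (h : symCoord K n θ = 0) : θ = 0 := by
  rw [← symOp_symCoord hθ, h]; simp [symOp]

end Operators

/-! ### Linear forms as primes -/

section LinearForms

variable {K : Type*} [Field K] {n : ℕ}

theorem eval_formPoly (α : Module.Dual K (Fin n → K)) (v : Fin n → K) :
    eval v (formPoly α) = α v := by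
  rw [LinearMap.pi_apply_eq_sum_univ α v]
  simp only [formPoly, map_sum, map_mul, eval_C, eval_X, smul_eq_mul]
  refine Finset.sum_congr rfl fun x _ => ?_
  rw [mul_comm]
  congr 2
  funext j
  simp [Pi.single_apply, eq_comm]

theorem pderiv_formPoly (α : Module.Dual K (Fin n → K)) (j : Fin n) :
    pderiv j (formPoly α) = C (α (Pi.single j 1)) := by
  simp [formPoly, pderiv_X, Pi.single_apply]

theorem exists_single_ne_zero {α : Module.Dual K (Fin n → K)} (hα : α ≠ 0) :
    ∃ i, α (Pi.single i 1) ≠ 0 := by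
  by_contra! h
  refine hα (LinearMap.pi_ext' fun i => LinearMap.ext_ring ?_)
  simpa using h i

theorem prime_formPoly {α : Module.Dual K (Fin n → K)} (hα : α ≠ 0) : Prime (formPoly α) := by
  obtain ⟨i, hi⟩ := exists_single_ne_zero hα
  have hcoeff : coeff (Finsupp.single i 1) (formPoly α) = α (Pi.single i 1) := by
    simp [formPoly, coeff_sum, coeff_C_mul, coeff_X, Finsupp.single_left_inj]
  have hne : formPoly α ≠ 0 := fun h => hi (by rw [← hcoeff, h, coeff_zero])
  have hhom : (formPoly α).IsHomogeneous 1 :=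
    IsHomogeneous.sum _ _ _ fun j _ => by
      simpa using (isHomogeneous_C _ _).mul (isHomogeneous_X K j)
  refine (irreducible_of_totalDegree_eq_one (hhom.totalDegree hne) fun x hx => ?_).prime
  exact isUnit_of_dvd_unit (hx (Finsupp.single i 1)) (by rw [hcoeff]; exact isUnit_iff_ne_zero.2 hi)

theorem not_formPoly_dvd {α : Module.Dual K (Fin n → K)} {f : MvPolynomial (Fin n) K}
    (v : Fin n → K) (hα : α v = 0) (hf : eval v f ≠ 0) : ¬ formPoly α ∣ f := by
  rintro ⟨g, rfl⟩
  exact hf (by rw [map_mul, eval_formPoly, hα, zero_mul])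

/-- Kernels are coatoms, so distinct ones are not nested: some point lies on the first hyperplane
and off the second. -/
theorem not_formPoly_dvd_formPoly {α β : Module.Dual K (Fin n → K)} (hα : α ≠ 0) (hβ : β ≠ 0)
    (h : LinearMap.ker α ≠ LinearMap.ker β) : ¬ formPoly α ∣ formPoly β := by
  have hle : ¬ LinearMap.ker α ≤ LinearMap.ker β := fun hle =>
    h (((LinearMap.isCoatom_ker_of_surjective (LinearMap.surjective hα)).le_iff.1 hle).resolve_left
      (fun h => hβ (LinearMap.ker_eq_top.1 h))).symm
  obtain ⟨v, hv, hv'⟩ := SetLike.not_le_iff_exists.1 hle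
  exact not_formPoly_dvd v hv (by rwa [eval_formPoly])

end LinearForms

/-! ### Local conditions at a hyperplane -/

section Preserving

variable {K : Type*} [Field K] [CharZero K] {n : ℕ}

/-- The coordinates of operators preserving `α R S` satisfy a divisibility condition with respect
to the linear form `α`. -/
theorem formPoly_dvd_of_mem_opsPreserving {α : Module.Dual K (Fin n → K)}
    {R : MvPolynomial (Fin n) K} (hα : α ≠ 0) (hR : ¬ formPoly α ∣ R)
    {θ : Module.End K (MvPolynomial (Fin n) K)} (hθ : θ ∈ opsPreserving 2 (formPoly α * R))
    (j : Fin n) :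
    -- Compare θ(αR x_j) with θ(αR) x_j: both are divisible by α, and by Leibniz their difference is
    -- R ∑ a_i F_ij modulo α. The factor R cancels because α is prime.
    formPoly α ∣ ∑ i, C (α (Pi.single i 1)) * symCoord K n θ s(i, j) := by
  obtain ⟨h2, hQ⟩ := hθ
  set F := symCoord K n θ with hF
  have hθF : symOp F = θ := symOp_symCoord h2
  have dvd_of_mem : ∀ g, formPoly α ∣ θ (formPoly α * R * g) := fun g =>
    (Dvd.intro _ rfl).trans (Ideal.mem_span_singleton.1 (hQ _ (Ideal.mem_span_singleton.2 ⟨g, rfl⟩)))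
  have h1 := dvd_of_mem (X j)
  have h0 := dvd_of_mem 1
  rw [mul_one] at h0
  rw [← hθF, symOp_mul, symOp_X, hθF] at h1
  have h3 : formPoly α ∣ R * ∑ i, C (α (Pi.single i 1)) * F s(i, j) := by
    rw [mul_zero, add_zero] at h1
    have h4 := (dvd_add_right (h0.mul_right (X j))).1 h1
    have h5 : ∑ i, ∑ k, F s(i, k) * pderiv i (formPoly α * R) * pderiv k (X j) =
        R * ∑ i, C (α (Pi.single i 1)) * F s(i, j) +
          formPoly α * ∑ i, F s(i, j) * pderiv i R := by
      simp only [Finset.mul_sum, ← Finset.sum_add_distrib]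
      refine Finset.sum_congr rfl fun i _ => ?_
      simp [pderiv_X, Pi.single_apply, pderiv_formPoly]
      ring
    rw [h5] at h4
    exact (dvd_add_left (Dvd.intro _ rfl)).1 h4
  exact ((prime_formPoly hα).dvd_or_dvd h3).resolve_left hR

/-- The factor R in front takes care of R, so only θ(αS) ⊆ αS is needed for θ with matrix F. Since θ
kills the linear form α, only the cross term of Leibniz's rule has to be checked. -/
theorem symOp_mem_opsPreserving {α : Module.Dual K (Fin n → K)}
    (R : MvPolynomial (Fin n) K) {F : Sym2 (Fin n) → MvPolynomial (Fin n) K}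
    (hF : ∀ j, formPoly α ∣ ∑ i, C (α (Pi.single i 1)) * F s(i, j)) :
    symOp (R • F) ∈ opsPreserving 2 (formPoly α * R) := by
  refine ⟨symOp_mem_homogOps _, fun g hg => ?_⟩
  rw [Ideal.mem_span_singleton] at hg ⊢
  obtain ⟨g, rfl⟩ := hg
  have h1 : symOp (R • F) (formPoly α * R * g) = symOp F (formPoly α * (R * g)) * R := by
    simp only [symOp_apply, Finset.sum_mul, Pi.smul_apply, smul_eq_mul, mul_assoc]
    refine Finset.sum_congr rfl fun i _ => Finset.sum_congr rfl fun j _ => ?_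
    ring
  rw [h1]
  refine mul_dvd_mul_right ?_ R
  have h0 : symOp F (formPoly α) = 0 := by
    simp [symOp_apply, pderiv_formPoly]
  rw [symOp_mul, h0, zero_mul, zero_add, Finset.sum_comm]
  refine dvd_add (Dvd.intro _ rfl) (Finset.dvd_sum fun j _ => ?_)
  rw [← Finset.sum_mul]
  refine Dvd.dvd.mul_right ?_ _
  simpa [pderiv_formPoly, mul_comm] using hF j

end Preserving

/-! ### Determinants of bases and congruence of symmetric matrices -/

section LinearAlgebra

/-- The independent rows `w` force full rank, so a basis is a square matrix, and every other tuple
is a matrix multiple of it. -/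
theorem exists_rows_det_dvd {A ι : Type*} [CommRing A] [IsDomain A] [IsNoetherianRing A]
    [Fintype ι] [DecidableEq ι] (N : Submodule A (ι → A)) [Module.Free A N]
    (w : ι → ι → A) (hw : ∀ i, w i ∈ N) (hdet : (Matrix.of w).det ≠ 0) :
    ∃ b : ι → ι → A, (∀ i, b i ∈ N) ∧
      ∀ u : ι → ι → A, (∀ i, u i ∈ N) → (Matrix.of b).det ∣ (Matrix.of u).det := by
  have hli : LinearIndependent A w := Matrix.linearIndependent_rows_of_det_ne_zero hdet
  have hli' : LinearIndependent A (fun i => (⟨w i, hw i⟩ : N)) :=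
    LinearIndependent.of_comp N.subtype hli
  have hrank : Module.finrank A N = Fintype.card ι := by
    refine le_antisymm ?_ hli'.fintype_card_le_finrank
    simpa using Submodule.finrank_le N
  let b : Module.Basis ι A N := (Module.finBasisOfFinrankEq A N hrank).reindex
    (Fintype.equivFin ι).symm
  refine ⟨fun i => b i, fun i => (b i).2, fun u hu => ?_⟩
  have hmul : Matrix.of u = (Matrix.of fun i j => b.repr ⟨u i, hu i⟩ j) *
      Matrix.of fun i => (b i : ι → A) := by
    ext i k
    have := congrFun (congrArg Subtype.val (b.sum_repr ⟨u i, hu i⟩)) k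
    simp only [AddSubmonoidClass.coe_finsetSum, Finset.sum_apply, SetLike.val_smul,
      Pi.smul_apply, smul_eq_mul] at this
    simp [Matrix.mul_apply, this]
  rw [hmul, Matrix.det_mul]
  exact Dvd.intro_left _ rfl

variable {A m : Type*}

/-- A function on unordered pairs as a symmetric matrix. -/
def symMatrix (F : Sym2 m → A) : Matrix m m A := Matrix.of fun i j => F s(i, j)

theorem symMatrix_injective : Function.Injective (symMatrix : (Sym2 m → A) → Matrix m m A) := by
  intro F G h
  funext e
  induction e with | _ i j
  exact congrFun (congrFun h i) j

variable [CommRing A] [Fintype m]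

/-- The action `F ↦ H F Hᵀ` of matrices on symmetric matrices. -/
def symCongr (H : Matrix m m A) : (Sym2 m → A) →ₗ[A] (Sym2 m → A) where
  toFun F := Sym2.lift ⟨fun i j => (H * symMatrix F * H.transpose) i j, fun i j => by
    change (H * symMatrix F * H.transpose) i j = (H * symMatrix F * H.transpose) j i
    rw [← Matrix.transpose_apply (H * symMatrix F * H.transpose) i j]
    have : (symMatrix F).transpose = symMatrix F := by
      ext i j; exact congrArg F Sym2.eq_swap
    rw [Matrix.transpose_mul, Matrix.transpose_mul, Matrix.transpose_transpose, this,
      Matrix.mul_assoc]⟩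
  map_add' F G := by
    funext e
    induction e with | _ i j
    have : symMatrix (F + G) = symMatrix F + symMatrix G := rfl
    simp [this, Matrix.mul_add, Matrix.add_mul]
  map_smul' c F := by
    funext e
    induction e with | _ i j
    have : symMatrix (c • F) = c • symMatrix F := rfl
    simp [this]

theorem symMatrix_symCongr (H : Matrix m m A) (F : Sym2 m → A) :
    symMatrix (symCongr H F) = H * symMatrix F * H.transpose := rfl

theorem symCongr_mk (H : Matrix m m A) (F : Sym2 m → A) (i j : m) :
    symCongr H F s(i, j) = ∑ b, (∑ a, H i a * F s(a, b)) * H j b := rfl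

theorem det_symCongr_rows [DecidableEq (Sym2 m)] (H : Matrix m m A) (w : Sym2 m → Sym2 m → A) :
    (Matrix.of fun e => symCongr H (w e)).det =
      LinearMap.det (symCongr H) * (Matrix.of w).det := by
  have := (Pi.basisFun A (Sym2 m)).det_comp (symCongr H) w
  rwa [Pi.basisFun_det] at this

variable [DecidableEq m]

theorem symCongr_symCongr {H G : Matrix m m A} (h : H * G = 1) (F : Sym2 m → A) :
    symCongr H (symCongr G F) = F := by
  apply symMatrix_injective
  calc symMatrix (symCongr H (symCongr G F))
      = (H * G) * symMatrix F * (H * G).transpose := by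
        simp only [symMatrix_symCongr, Matrix.transpose_mul, Matrix.mul_assoc]
    _ = symMatrix F := by simp [h]

theorem isUnit_det_symCongr {H G : Matrix m m A} (h : H * G = 1) :
    IsUnit (LinearMap.det (symCongr H)) := by
  refine IsUnit.of_mul_eq_one (LinearMap.det (symCongr G)) ?_
  rw [← LinearMap.det_comp]
  have : symCongr H ∘ₗ symCongr G = LinearMap.id := LinearMap.ext fun F => symCongr_symCongr h F
  rw [this, LinearMap.det_id]

/-- The rank one matrix u gᵀ squares to zero. -/
theorem one_add_vecMulVec_mul {u g : m → A} (h : g ⬝ᵥ u = 0) :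
    (1 + Matrix.vecMulVec u g) * (1 - Matrix.vecMulVec u g) = 1 := by
  have h0 : Matrix.vecMulVec u g * Matrix.vecMulVec u g = 0 := by
    rw [Matrix.vecMulVec_mul_vecMulVec, h]; simp
  rw [mul_sub, add_mul, add_mul, h0]; simp

theorem card_filter_mem_sym2 (i : m) :
    (Finset.univ.filter fun e : Sym2 m => i ∈ e).card = Fintype.card m := by
  have : (Finset.univ.filter fun e : Sym2 m => i ∈ e) =
      Finset.univ.image fun j => s(i, j) := by
    ext e
    simp [Sym2.mem_iff_exists, eq_comm]
  rw [this, Finset.card_image_of_injective _ fun a b h => Sym2.congr_right.1 h, Finset.card_univ]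

end LinearAlgebra

/-! ### Combining divisibilities prime by prime -/

section Factorization

variable {A : Type*} [CommRing A] [IsDomain A] [WfDvdMonoid A]

/-- The first divisibility bounds the multiplicity of a in P by k; the second shows that the part of
P prime to a divides U. -/
theorem _root_.Prime.dvd_pow_mul_of_dvd {a P U V : A} (ha : Prime a) (hP : P ≠ 0) {k N : ℕ}
    (hV : ¬ a ∣ V) (h1 : P ∣ a ^ k * V) (h2 : P ∣ a ^ N * U) : P ∣ a ^ k * U := by
  obtain ⟨r, P', hP', rfl⟩ := WfDvdMonoid.max_power_factor hP ha.irreducible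
  have hr : a ^ r ∣ a ^ k := ha.pow_dvd_of_dvd_mul_right r hV ((Dvd.intro _ rfl).trans h1)
  refine mul_dvd_mul hr ?_
  obtain ⟨c, hc⟩ := (Dvd.intro_left _ rfl).trans h2
  obtain ⟨d, rfl⟩ := ha.pow_dvd_of_dvd_mul_left N hP' ⟨U, hc.symm⟩
  exact ⟨d, mul_left_cancel₀ (pow_ne_zero N ha.ne_zero) (by rw [hc]; ring)⟩

theorem dvd_prod_pow_of_forall {σ : Type*} [Fintype σ] [DecidableEq σ] [Nonempty σ] {a : σ → A}
    (ha : ∀ s, Prime (a s)) (hne : ∀ s t, s ≠ t → ¬ a s ∣ a t) {P : A} (hP : P ≠ 0) {k N : ℕ}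
    (hkN : k ≤ N) (h : ∀ s, P ∣ a s ^ k * (∏ t ∈ Finset.univ.erase s, a t) ^ N) :
    P ∣ (∏ s, a s) ^ k := by
  -- The exponents are lowered from N to k one prime at a time, T being the set already treated.
  have main : ∀ T : Finset σ, P ∣ (∏ t ∈ T, a t ^ k) * ∏ t ∈ Finset.univ \ T, a t ^ N := by
    intro T
    induction T using Finset.induction_on with
    | empty =>
      obtain ⟨s⟩ := ‹Nonempty σ›
      refine (h s).trans ?_
      rw [Finset.prod_empty, one_mul, Finset.sdiff_empty, ← Finset.prod_pow,
        ← Finset.mul_prod_erase Finset.univ (fun t => a t ^ N) (Finset.mem_univ s)]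
      exact mul_dvd_mul_right (pow_dvd_pow _ hkN) _
    | insert s T hs ih =>
      rw [Finset.prod_insert hs, mul_assoc]
      refine (ha s).dvd_pow_mul_of_dvd hP (N := N) ?_ (h s) ?_
      · intro hdvd
        obtain ⟨t, ht, hd⟩ := (ha s).exists_mem_finset_dvd ((ha s).dvd_of_dvd_pow hdvd)
        exact hne s t (Finset.ne_of_mem_erase ht).symm hd
      · have hmem : s ∈ Finset.univ \ T := by simp [hs]
        rw [← Finset.mul_prod_erase _ _ hmem] at ih
        have : Finset.univ \ insert s T = (Finset.univ \ T).erase s := by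
          ext; simp [not_or]
        rw [this, mul_left_comm]
        exact ih
  simpa [Finset.prod_pow] using main Finset.univ

end Factorization

/-! ### The determinant of a basis divides Q^n -/

section Coordinates

variable {K : Type*} [Field K] [CharZero K] {n : ℕ}

/-- The module of coordinates of the second order operators preserving `Q S`. -/
def symModule (Q : MvPolynomial (Fin n) K) :
    Submodule (MvPolynomial (Fin n) K) (Sym2 (Fin n) → MvPolynomial (Fin n) K) :=
  (opsPreserving 2 Q).map (symCoord K n)

theorem free_symModule (Q : MvPolynomial (Fin n) K)
    [Module.Free (MvPolynomial (Fin n) K) (opsPreserving 2 Q)] :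
    Module.Free (MvPolynomial (Fin n) K) (symModule Q) := by
  have hinj : Function.Injective ((symCoord K n).submoduleMap (opsPreserving 2 Q)) := by
    rw [injective_iff_map_eq_zero]
    intro θ h
    exact Subtype.ext (symCoord_injOn θ.2.1 (congrArg Subtype.val h))
  exact Module.Free.of_equiv (LinearEquiv.ofBijective _
    ⟨hinj, (symCoord K n).submoduleMap_surjective (opsPreserving 2 Q)⟩)

theorem formPoly_dvd_of_mem_symModule {α : Module.Dual K (Fin n → K)}
    {R : MvPolynomial (Fin n) K} (hα : α ≠ 0) (hR : ¬ formPoly α ∣ R)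
    {F : Sym2 (Fin n) → MvPolynomial (Fin n) K} (hF : F ∈ symModule (formPoly α * R))
    (j : Fin n) : formPoly α ∣ ∑ i, C (α (Pi.single i 1)) * F s(i, j) := by
  obtain ⟨θ, hθ, rfl⟩ := hF
  exact formPoly_dvd_of_mem_opsPreserving hα hR hθ j

theorem smul_mem_symModule {α : Module.Dual K (Fin n → K)}
    (R : MvPolynomial (Fin n) K) {F : Sym2 (Fin n) → MvPolynomial (Fin n) K}
    (hF : ∀ j, formPoly α ∣ ∑ i, C (α (Pi.single i 1)) * F s(i, j)) :
    R • F ∈ symModule (formPoly α * R) :=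
  ⟨_, symOp_mem_opsPreserving R hF, symCoord_symOp _⟩

/-- A tuple in `symModule (α R)` whose determinant is associated to
`α ^ n R ^ (n (n + 1) / 2)`. -/
theorem exists_rows_symModule {α : Module.Dual K (Fin n → K)} (hα : α ≠ 0)
    (R : MvPolynomial (Fin n) K) :
    ∃ w : Sym2 (Fin n) → Sym2 (Fin n) → MvPolynomial (Fin n) K,
      (∀ e, w e ∈ symModule (formPoly α * R)) ∧
      Associated (Matrix.of w).det (formPoly α ^ n * R ^ Fintype.card (Sym2 (Fin n))) := by
  obtain ⟨i₀, hi₀⟩ := exists_single_ne_zero hα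
  set a : Fin n → K := fun i => α (Pi.single i 1) with ha
  let u : Fin n → MvPolynomial (Fin n) K := Pi.single i₀ 1
  let g : Fin n → MvPolynomial (Fin n) K := fun i => if i = i₀ then 0 else C (-(a i / a i₀))
  -- W is a unimodular change of coordinates in which α becomes a multiple of the coordinate i₀. The
  -- condition at α then concerns only the n entries with i₀ in the index; these get the factor α.
  let W : Matrix (Fin n) (Fin n) (MvPolynomial (Fin n) K) := 1 + Matrix.vecMulVec u g
  have hW : W * (1 - Matrix.vecMulVec u g) = 1 := one_add_vecMulVec_mul (by simp [u, g])
  have haW : ∀ b, ∑ i, C (a i) * W i b = if b = i₀ then C (a i₀) else 0 := by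
    intro b
    simp only [W, Matrix.add_apply, Matrix.one_apply, Matrix.vecMulVec_apply, mul_add,
      Finset.sum_add_distrib, u, Pi.single_apply, ite_mul, mul_ite, one_mul, zero_mul, mul_one,
      mul_zero, Finset.sum_ite_eq',
      Finset.mem_univ, if_true, g]
    split_ifs with hb
    · simp [hb]
    · rw [Finset.sum_ite_eq' Finset.univ i₀, if_pos (Finset.mem_univ _), ← C_mul, ← C_add]
      rw [show a b + a i₀ * -(a b / a i₀) = 0 by rw [mul_neg, mul_div_cancel₀ _ hi₀, add_neg_cancel], C_0]
  let c : Sym2 (Fin n) → MvPolynomial (Fin n) K := fun e => if i₀ ∈ e then formPoly α else 1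
  refine ⟨fun e => symCongr W ((R * c e) • Pi.single e 1), fun e => ?_, ?_⟩
  · change symCongr W ((R * c e) • Pi.single e 1) ∈ _
    rw [mul_smul, map_smul]
    refine smul_mem_symModule R fun j => ?_
    set G : Sym2 (Fin n) → MvPolynomial (Fin n) K := c e • Pi.single e 1 with hG
    have hsum : ∑ i, C (a i) * symCongr W G s(i, j) =
        ∑ b, (∑ i, C (a i) * W i b) * ∑ k, G s(b, k) * W j k := by
      simp only [symCongr_mk, Finset.sum_mul, Finset.mul_sum]
      rw [Finset.sum_comm_cycle]
      refine Finset.sum_congr rfl fun b _ => ?_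
      rw [Finset.sum_comm]
      refine Finset.sum_congr rfl fun k _ => Finset.sum_congr rfl fun i _ => ?_
      ring
    change formPoly α ∣ ∑ i, C (a i) * symCongr W G s(i, j)
    rw [hsum]
    refine Finset.dvd_sum fun b _ => ?_
    rw [haW]
    split_ifs with hb
    · subst hb
      refine Dvd.dvd.mul_left (Finset.dvd_sum fun k _ => Dvd.dvd.mul_right ?_ _) _
      simp only [hG, Pi.smul_apply, Pi.single_apply, smul_eq_mul, mul_ite, mul_one, mul_zero]
      split_ifs with hk
      · simp [c, ← hk]
      · exact dvd_zero _
    · simp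
  · rw [det_symCongr_rows]
    have hdiag : (Matrix.of fun e => (R * c e) •
        (Pi.single e 1 : Sym2 (Fin n) → MvPolynomial (Fin n) K)) =
        Matrix.diagonal fun e => R * c e := by
      ext e e'
      simp [Matrix.diagonal_apply, Pi.single_apply, eq_comm]
    rw [hdiag, Matrix.det_diagonal, Finset.prod_mul_distrib, Finset.prod_const, Finset.card_univ]
    have hc : ∏ e, c e = formPoly α ^ n := by
      simp only [c, Finset.prod_ite, Finset.prod_const, one_pow, mul_one,
        card_filter_mem_sym2, Fintype.card_fin]
    rw [hc, mul_comm (R ^ _)]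
    exact associated_unit_mul_left _ _ (isUnit_det_symCongr hW)

/-- If the arrangement of the kernels of the forms `α_s` is `2`-free, then the determinant of a
basis divides `Q ^ n`. -/
theorem exists_rows_det_dvd_pow {σ : Type*} [Fintype σ] [DecidableEq σ] [Nonempty σ]
    (α : σ → Module.Dual K (Fin n → K)) (hα : ∀ s, α s ≠ 0)
    (hker : Function.Injective fun s => LinearMap.ker (α s))
    [Module.Free (MvPolynomial (Fin n) K) (opsPreserving 2 (∏ s, formPoly (α s)))] :
    ∃ b : Sym2 (Fin n) → Sym2 (Fin n) → MvPolynomial (Fin n) K,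
      (∀ e, ∀ s j, formPoly (α s) ∣ ∑ i, C (α s (Pi.single i 1)) * b e s(i, j)) ∧
      (Matrix.of b).det ∣ (∏ s, formPoly (α s)) ^ n := by
  have hprime : ∀ s, Prime (formPoly (α s)) := fun s => prime_formPoly (hα s)
  have hne : ∀ s t, s ≠ t → ¬ formPoly (α s) ∣ formPoly (α t) := fun s t h =>
    not_formPoly_dvd_formPoly (hα s) (hα t) (hker.ne h)
  set Q := ∏ s, formPoly (α s) with hQ
  let R : σ → MvPolynomial (Fin n) K := fun s => ∏ t ∈ Finset.univ.erase s, formPoly (α t)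
  have hQR : ∀ s, formPoly (α s) * R s = Q := fun s =>
    Finset.mul_prod_erase Finset.univ (fun t => formPoly (α t)) (Finset.mem_univ s)
  have hR : ∀ s, ¬ formPoly (α s) ∣ R s := by
    intro s hdvd
    obtain ⟨t, ht, hd⟩ := (hprime s).exists_mem_finset_dvd hdvd
    exact hne s t (Finset.ne_of_mem_erase ht).symm hd
  have hR0 : ∀ s, R s ≠ 0 := fun s => Finset.prod_ne_zero_iff.2 fun t _ => (hprime t).ne_zero
  have hfree := free_symModule Q
  have hrows : ∀ s, ∃ w : Sym2 (Fin n) → Sym2 (Fin n) → MvPolynomial (Fin n) K,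
      (∀ e, w e ∈ symModule Q) ∧ Associated (Matrix.of w).det
        (formPoly (α s) ^ n * R s ^ Fintype.card (Sym2 (Fin n))) := by
    intro s
    rw [← hQR s]
    exact exists_rows_symModule (hα s) (R s)
  have hne0 : ∀ s, formPoly (α s) ^ n * R s ^ Fintype.card (Sym2 (Fin n)) ≠ 0 := fun s =>
    mul_ne_zero (pow_ne_zero _ (hprime s).ne_zero) (pow_ne_zero _ (hR0 s))
  obtain ⟨s₀⟩ := ‹Nonempty σ›
  obtain ⟨w₀, hw₀, hdet₀⟩ := hrows s₀
  obtain ⟨b, hb, hbdvd⟩ := exists_rows_det_dvd (symModule Q) w₀ hw₀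
    ((hdet₀.ne_zero_iff).2 (hne0 s₀))
  have hdvd : ∀ s, (Matrix.of b).det ∣
      formPoly (α s) ^ n * R s ^ Fintype.card (Sym2 (Fin n)) := by
    intro s
    obtain ⟨w, hw, hdet⟩ := hrows s
    exact (hbdvd w hw).trans hdet.dvd
  refine ⟨b, fun e s j => ?_, ?_⟩
  · have := hb e
    rw [← hQR s] at this
    exact formPoly_dvd_of_mem_symModule (hα s) (hR s) this j
  · have : Nonempty σ := ⟨s₀⟩
    refine dvd_prod_pow_of_forall hprime hne (N := Fintype.card (Sym2 (Fin n)))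
      (fun h => hne0 s₀ (zero_dvd_iff.1 (h ▸ hdvd s₀))) ?_ hdvd
    calc n = Fintype.card (Fin n) := (Fintype.card_fin n).symm
      _ ≤ _ := Fintype.card_le_of_injective (fun i => s(i, i)) fun i j h => by simpa using h

end Coordinates

/-! ### Local computation for Shi_2 -/

section RankThree

/-- Three elements `x, y, z` of a domain which behave like coordinates at a point with respect to
the seven forms of `Shi_2`, and a ring homomorphism restricting to the line of slope
`(x : y : z) = (-1 : 2 : 1)` through this point, with local parameter `t`. -/
structure IsShiTriple {S B : Type*} [CommRing S] [CommRing B] (x y z : S) (φ : S →+* B) (t : B) :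
    Prop where
  prime_x : Prime x
  prime_y : Prime y
  prime_z : Prime z
  prime_xz : Prime (x - z)
  prime_yz : Prime (y - z)
  prime_xy : Prime (x - y)
  prime_xyz : Prime (x - y - z)
  x_yz : ¬ x ∣ y - z
  y_x : ¬ y ∣ x
  y_xz : ¬ y ∣ x - z
  z_x : ¬ z ∣ x
  z_y : ¬ z ∣ y
  z_xy : ¬ z ∣ x - y
  xz_z : ¬ x - z ∣ z
  yz_z : ¬ y - z ∣ z
  yz_xz : ¬ y - z ∣ x - z
  xy_y : ¬ x - y ∣ y
  xyz_y : ¬ x - y - z ∣ y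
  xyz_z : ¬ x - y - z ∣ z
  lin : ∀ a b c, x * a + y * b + z * c = 0 → t ∣ φ a ∧ t ∣ φ b ∧ t ∣ φ c
  two : ∀ b, t ∣ 2 * b → t ∣ b
  map_x : φ x = -t
  map_y : φ y = 2 * t
  map_z : φ z = t

/-- The divisibility conditions satisfied by the coefficients of a derivation in `D(Shi_2)`. -/
structure ShiDvd {S : Type*} [CommRing S] (x y z u₀ u₁ u₂ : S) : Prop where
  z_dvd : z ∣ u₀
  x_dvd : x ∣ u₁
  y_dvd : y ∣ u₂
  xz_dvd : x - z ∣ u₁ - u₀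
  yz_dvd : y - z ∣ u₂ - u₀
  xy_dvd : x - y ∣ u₁ - u₂
  xyz_dvd : x - y - z ∣ u₁ - u₂ - u₀

variable {S B : Type*} [CommRing S] [IsDomain S] [CommRing B] {x y z : S} {φ : S →+* B} {t : B}

/-- Since x - y = (x - z) - (y - z), the relation is a syzygy between x - z and y - z. -/
theorem IsShiTriple.exists_of_mul_sub_eq (h : IsShiTriple x y z φ t) {p q r : S}
    (he : (x - z) * p - (y - z) * q = (x - y) * r) :
    ∃ m, p = r + (y - z) * m ∧ q = r + (x - z) * m := by
  have he' : (x - z) * (p - r) = (y - z) * (q - r) := by linear_combination he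
  obtain ⟨m, hm⟩ := (h.prime_yz.dvd_or_dvd (Dvd.intro _ he'.symm)).resolve_left h.yz_xz
  refine ⟨m, by linear_combination hm, ?_⟩
  refine mul_left_cancel₀ h.prime_yz.ne_zero ?_
  linear_combination -he' + (x - z) * hm

/-- Write u₀ = za, u₁ = xb, u₂ = yc. Modulo x - z the condition there reads z(b - a) ≡ 0, so p is
the quotient of b - a by x - z; q and r arise likewise from c - a and b - c. Modulo x - y - z the
last condition becomes yz(r + p) ≡ 0. -/
theorem ShiDvd.exists_eq {u₀ u₁ u₂ : S} (hu : ShiDvd x y z u₀ u₁ u₂)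
    (h : IsShiTriple x y z φ t) :
    ∃ a p q r m m', u₀ = z * a ∧ u₁ = x * (a + (x - z) * p) ∧ u₂ = y * (a + (y - z) * q) ∧
      (x - z) * p - (y - z) * q = (x - y) * r ∧
      p = r + (y - z) * m ∧ q = r + (x - z) * m ∧ r + p = (x - y - z) * m' := by
  obtain ⟨a, rfl⟩ := hu.z_dvd
  obtain ⟨b, rfl⟩ := hu.x_dvd
  obtain ⟨c, rfl⟩ := hu.y_dvd
  obtain ⟨k₁, h₁⟩ := hu.xz_dvd
  obtain ⟨k₂, h₂⟩ := hu.yz_dvd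
  obtain ⟨k₃, h₃⟩ := hu.xy_dvd
  obtain ⟨k₄, h₄⟩ := hu.xyz_dvd
  obtain ⟨p, hp⟩ := (h.prime_xz.dvd_or_dvd (a := z) (b := b - a)
    ⟨k₁ - b, by linear_combination h₁⟩).resolve_left h.xz_z
  obtain ⟨q, hq⟩ := (h.prime_yz.dvd_or_dvd (a := z) (b := c - a)
    ⟨k₂ - c, by linear_combination h₂⟩).resolve_left h.yz_z
  obtain ⟨r, hr⟩ := (h.prime_xy.dvd_or_dvd (a := y) (b := b - c)
    ⟨k₃ - b, by linear_combination h₃⟩).resolve_left h.xy_y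
  have he : (x - z) * p - (y - z) * q = (x - y) * r := by linear_combination hr - hp + hq
  obtain ⟨m, hm, hm'⟩ := h.exists_of_mul_sub_eq he
  have h₅ : x - y - z ∣ y * (z * (r + p)) :=
    ⟨k₄ - b - y * r - z * p, by linear_combination h₄ - y * hr - z * hp⟩
  obtain ⟨m', hm''⟩ := (h.prime_xyz.dvd_or_dvd ((h.prime_xyz.dvd_or_dvd h₅).resolve_left
    h.xyz_y)).resolve_left h.xyz_z
  exact ⟨a, p, q, r, m, m', rfl, by linear_combination x * hp, by linear_combination y * hq, he,
    hm, hm', hm''⟩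

/-- Along the line, a derivation in `D(Shi_2)` is a multiple of the Euler derivation up to
third order. -/
theorem ShiDvd.map_dvd {u₀ u₁ u₂ : S} (hu : ShiDvd x y z u₀ u₁ u₂)
    (h : IsShiTriple x y z φ t) :
    t ∣ φ u₀ ∧ t ^ 3 ∣ φ u₁ + φ u₀ ∧ t ^ 3 ∣ φ u₂ - 2 * φ u₀ := by
  obtain ⟨a, p, q, r, m, m', rfl, rfl, rfl, -, hp, hq, hr⟩ := hu.exists_eq h
  have hp' := congrArg φ hp
  have hq' := congrArg φ hq
  have hr' := congrArg φ hr
  simp only [map_add, map_mul, map_sub, h.map_x, h.map_y, h.map_z] at hp' hq' hr' ⊢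
  -- On the line p ≡ r and r + p ≡ 0 modulo t, hence t ∣ 2r.
  obtain ⟨R, hR⟩ := h.two (φ r) ⟨-4 * φ m' - φ m, by linear_combination hr' - hp'⟩
  refine ⟨Dvd.intro _ rfl, ⟨2 * (R + φ m), ?_⟩, ⟨2 * (R - 2 * φ m), ?_⟩⟩
  · linear_combination 2 * t ^ 2 * (hp' + hR)
  · linear_combination 2 * t ^ 2 * (hq' + hR)

/-- Along the line, an operator in `D^(2)(Shi_2)` is a multiple of the square of the Euler
derivation up to fourth order. -/
theorem ShiDvd.map_dvd_of_symm {u₀₀ u₀₁ u₀₂ u₁₁ u₁₂ u₂₂ : S}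
    (hu₀ : ShiDvd x y z u₀₀ u₀₁ u₀₂) (hu₁ : ShiDvd x y z u₀₁ u₁₁ u₁₂)
    (hu₂ : ShiDvd x y z u₀₂ u₁₂ u₂₂) (h : IsShiTriple x y z φ t) :
    t ^ 2 ∣ φ u₀₀ ∧ t ^ 4 ∣ φ u₀₁ + φ u₀₀ ∧ t ^ 4 ∣ φ u₀₂ - 2 * φ u₀₀ ∧
      t ^ 4 ∣ φ u₁₁ + 2 * φ u₀₁ + φ u₀₀ ∧
      t ^ 4 ∣ φ u₁₂ + φ u₀₂ - 2 * φ u₀₁ - 2 * φ u₀₀ ∧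
      t ^ 4 ∣ φ u₂₂ - 4 * φ u₀₂ + 4 * φ u₀₀ := by
  obtain ⟨a₀, p₀, q₀, r₀, m₂, m₁, e00, e10, e20, er₀, hp₀, hq₀, hm₁⟩ := hu₀.exists_eq h
  obtain ⟨a₁, p₁, q₁, r₁, m₃, m₄, e01, e11, e21, -, hp₁, hq₁, hm₄⟩ := hu₁.exists_eq h
  obtain ⟨a₂, p₂, q₂, r₂, m₅, m₆, e02, e12, e22, -, hp₂, hq₂, hm₆⟩ := hu₂.exists_eq h
  have x0 := h.prime_x.ne_zero
  have y0 := h.prime_y.ne_zero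
  have z0 := h.prime_z.ne_zero
  -- factor the entries off the diagonal
  obtain ⟨a', ha'⟩ := (h.prime_z.dvd_or_dvd (Dvd.intro a₁ (e01.symm.trans e10))).resolve_left h.z_x
  have ha₁ : a₁ = x * a' := mul_left_cancel₀ z0 (by linear_combination e10 - e01 + x * ha')
  obtain ⟨a'', ha''⟩ :=
    (h.prime_z.dvd_or_dvd (Dvd.intro a₂ (e02.symm.trans e20))).resolve_left h.z_y
  have ha₂ : a₂ = y * a'' := mul_left_cancel₀ z0 (by linear_combination e20 - e02 + y * ha'')
  obtain ⟨b', hb'⟩ := (h.prime_y.dvd_or_dvd (Dvd.intro _ (e21.symm.trans e12))).resolve_left h.y_x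
  have hc₁ : a₁ + (y - z) * q₁ = x * b' :=
    mul_left_cancel₀ y0 (by linear_combination e12 - e21 + x * hb')
  obtain ⟨q', hq'⟩ := (h.prime_x.dvd_or_dvd (a := y - z) (b := q₁)
    ⟨b' - a', by linear_combination hc₁ - ha₁⟩).resolve_left h.x_yz
  obtain ⟨p', hp'⟩ := (h.prime_y.dvd_or_dvd (a := x - z) (b := p₂)
    ⟨b' - a'', by linear_combination hb' - ha₂⟩).resolve_left h.y_xz
  obtain ⟨k, hk⟩ := (h.prime_z.dvd_or_dvd (a := x - y) (b := r₀)
    ⟨a' - a'', by linear_combination ha' - ha'' - er₀⟩).resolve_left h.z_xy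
  have hbq : b' - a' = (y - z) * q' :=
    mul_left_cancel₀ x0 (by linear_combination ha₁ - hc₁ + (y - z) * hq')
  have hbp : b' - a'' = (x - z) * p' :=
    mul_left_cancel₀ y0 (by linear_combination ha₂ - hb' + (x - z) * hp')
  have hak : a' - a'' = (x - y) * k :=
    mul_left_cancel₀ z0 (by linear_combination ha'' - ha' + er₀ + (x - y) * hk)
  -- By symmetry the off-diagonal entries are zxa', zya'', xyb', whose pairwise differences satisfy
  -- the same syzygy. In particular r₀ = zk, which is what gains an extra order in the first column.
  obtain ⟨m₀, hm₀, hm₀'⟩ := h.exists_of_mul_sub_eq (p := p') (q := q') (r := k)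
    (by linear_combination hak - hbp + hbq)
  -- linear terms
  obtain ⟨-, ⟨t₁, ht₁⟩, ⟨t₂, ht₂⟩⟩ := h.lin m₁ (-m₁ - m₂) (-m₁ - 2 * k + m₂)
    (by linear_combination -hm₁ + hp₀ + 2 * hk)
  obtain ⟨⟨t₀, ht₀⟩, -, -⟩ := h.lin m₁ (-m₁ - m₂) (-m₁ - 2 * k + m₂)
    (by linear_combination -hm₁ + hp₀ + 2 * hk)
  obtain ⟨⟨t₃, ht₃⟩, ⟨t₄, ht₄⟩, -⟩ := h.lin (2 * q' - 2 * m₃ - m₄) (m₃ + m₄) (m₃ + m₄)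
    (by linear_combination hm₄ - hp₁ + 2 * hq₁ - 2 * hq')
  obtain ⟨⟨t₅, ht₅⟩, -, ⟨t₆, ht₆⟩⟩ := h.lin (-m₆) (2 * p' - m₅ + m₆) (m₅ + m₆)
    (by linear_combination hm₆ + hp₂ - 2 * hp')
  simp only [map_add, map_mul, map_sub, map_neg, map_ofNat] at ht₀ ht₁ ht₂ ht₃ ht₄ ht₅ ht₆
  have hM₂ : φ m₂ = t * (-t₀ - t₁) := by linear_combination -ht₀ - ht₁
  -- The relation -m₁ - 2k + m₂ ≡ 0 modulo t, together with t ∣ m₁ and t ∣ m₂, gives t ∣ 2k.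
  obtain ⟨k', hk'⟩ := h.two (φ k) ⟨-t₀ - t₂ + (-t₀ - t₁), by linear_combination hM₂ - ht₀ - ht₂⟩
  have hM₅ : φ m₅ = t * (t₅ + t₆) := by linear_combination ht₅ + ht₆
  have gp' := congrArg φ hm₀
  have gq' := congrArg φ hm₀'
  have gp₀ := congrArg φ (hp₀.trans (by rw [hk]) : p₀ = z * k + (y - z) * m₂)
  have gq₀ := congrArg φ (hq₀.trans (by rw [hk]) : q₀ = z * k + (x - z) * m₂)
  have gp₁ := congrArg φ (by linear_combination hp₁ - hq₁ + hq' : p₁ = x * q' - (x - y) * m₃)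
  have gq₂ := congrArg φ (by linear_combination hq₂ - hp₂ + hp' : q₂ = y * p' + (x - y) * m₅)
  have f00 := congrArg φ e00
  have fa₀ := congrArg φ ha'
  have fa₀' := congrArg φ ha''
  have f01 := congrArg φ (e01.trans (by rw [ha₁]) : u₀₁ = z * (x * a'))
  have f02 := congrArg φ (e02.trans (by rw [ha₂]) : u₀₂ = z * (y * a''))
  have f11 := congrArg φ (e11.trans (by rw [ha₁]) : u₁₁ = x * (x * a' + (x - z) * p₁))
  have f12 := congrArg φ (e21.trans (by rw [hc₁]) : u₁₂ = y * (x * b'))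
  have f22 := congrArg φ (e22.trans (by rw [ha₂]) : u₂₂ = y * (y * a'' + (y - z) * q₂))
  have fb := congrArg φ hbq
  have fk := congrArg φ hak
  simp only [map_add, map_mul, map_sub, h.map_x, h.map_y, h.map_z] at gp' gq' gp₀ gq₀ gp₁ gq₂ f00 fa₀ fa₀' f01 f02 f11 f12 f22 fb fk
  have hP₀ : φ p₀ = t ^ 2 * (k' - t₀ - t₁) := by linear_combination gp₀ + t * hk' + t * hM₂
  have hQ₀ : φ q₀ = t ^ 2 * (k' + 2 * t₀ + 2 * t₁) := by
    linear_combination gq₀ + t * hk' - 2 * t * hM₂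
  have hQ' : φ q' = t * (k' - 2 * φ m₀) := by linear_combination gq' + hk'
  have hP' : φ p' = t * (k' + φ m₀) := by linear_combination gp' + hk'
  have hP₁ : φ p₁ = t ^ 2 * (5 * (k' - 2 * φ m₀) - 3 * (t₃ + t₄)) := by
    linear_combination gp₁ - 3 * t * ht₃ - 3 * t * ht₄ + 5 * t * hQ'
  have hQ₂ : φ q₂ = t ^ 2 * (2 * (k' + φ m₀) - 3 * (t₅ + t₆)) := by
    linear_combination gq₂ + 2 * t * hP' - 3 * t * hM₅
  have d00 : φ u₀₀ = t ^ 2 * (φ a' + 2 * φ p₀) := by linear_combination f00 + t * fa₀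
  have d01 : φ u₀₁ + φ u₀₀ = 2 * t ^ 2 * φ p₀ := by linear_combination d00 + f01
  have d02 : φ u₀₂ - 2 * φ u₀₀ = 2 * t ^ 2 * φ q₀ := by
    linear_combination f02 - 2 * f00 - 2 * t * fa₀'
  have d11 : φ u₁₁ + 2 * φ u₀₁ + φ u₀₀ = 2 * t ^ 2 * (φ p₁ + φ p₀) := by
    linear_combination f11 + 2 * f01 + d00
  have d12 : φ u₁₂ + φ u₀₂ - 2 * φ u₀₁ - 2 * φ u₀₀ = 2 * t ^ 2 * (φ q₀ - t * φ q') := by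
    linear_combination f12 + d02 - 2 * f01 - 2 * t ^ 2 * fb
  have d22 : φ u₂₂ - 4 * φ u₀₂ + 4 * φ u₀₀ = 2 * t ^ 2 * (φ q₂ - 2 * φ q₀) := by
    linear_combination f22 - 2 * d02 - 2 * f02
  rw [d01, d02, d11, d12, d22, hP₀, hQ₀, hQ', hP₁, hQ₂]
  refine ⟨⟨_, d00⟩, ?_, ?_, ?_, ?_, ?_⟩
  · exact ⟨2 * (k' - t₀ - t₁), by ring⟩
  · exact ⟨2 * (k' + 2 * t₀ + 2 * t₁), by ring⟩
  · exact ⟨2 * ((5 * (k' - 2 * φ m₀) - 3 * (t₃ + t₄)) + (k' - t₀ - t₁)), by ring⟩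
  · exact ⟨2 * (k' + 2 * t₀ + 2 * t₁ - (k' - 2 * φ m₀)), by ring⟩
  · exact ⟨2 * ((2 * (k' + φ m₀) - 3 * (t₅ + t₆)) - 2 * (k' + 2 * t₀ + 2 * t₁)), by ring⟩

end RankThree

/-! ### The test line and the order of Q along it -/

section Line

variable (K : Type*) [Field K] (r : ℕ)

/-- A point at which exactly the hyperplanes of `Shi_2` meet. -/
def basePoint : Fin (r + 3) → K := fun i => if i.val < 3 then 0 else (i.val : K)

/-- A direction transversal to the hyperplanes through `basePoint`. -/
def direction : Fin (r + 3) → K := fun i =>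
  if i.val = 0 then 1 else if i.val = 1 then -1 else if i.val = 2 then 2 else 0

theorem basePoint_eq_zero : basePoint K r 0 = 0 ∧ basePoint K r 1 = 0 ∧ basePoint K r 2 = 0 := by
  have hmod : 2 % (r + 3) = 2 := Nat.mod_eq_of_lt (by omega)
  simp [basePoint, hmod]

theorem direction_eq : direction K r 0 = 1 ∧ direction K r 1 = -1 ∧ direction K r 2 = 2 := by
  have hmod : 2 % (r + 3) = 2 := Nat.mod_eq_of_lt (by omega)
  simp [direction, hmod]

/-- Restriction of polynomials to the line through `basePoint` with the given direction. -/
def toLine : MvPolynomial (Fin (r + 3)) K →+* Polynomial K :=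
  (aeval fun i => Polynomial.C (basePoint K r i) +
    Polynomial.X * Polynomial.C (direction K r i)).toRingHom

theorem toLine_X (i : Fin (r + 3)) : toLine K r (X i) = Polynomial.C (basePoint K r i) +
    Polynomial.X * Polynomial.C (direction K r i) := by
  simp [toLine]

theorem toLine_formPoly (α : Module.Dual K (Fin (r + 3) → K)) :
    toLine K r (formPoly α) = Polynomial.C (α (basePoint K r)) +
      Polynomial.X * Polynomial.C (α (direction K r)) := by
  have hC : ∀ a : K, toLine K r (C a) = Polynomial.C a := fun a => by
    simp [toLine, Polynomial.algebraMap_eq]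
  rw [← eval_formPoly, ← eval_formPoly, formPoly]
  simp only [map_sum, map_mul, hC, toLine_X, eval_C, eval_X, mul_add, Finset.sum_add_distrib,
    Finset.mul_sum]
  congr 1
  exact Finset.sum_congr rfl fun i _ => by ring

theorem X_dvd_toLine_iff (f : MvPolynomial (Fin (r + 3)) K) :
    Polynomial.X ∣ toLine K r f ↔ eval (basePoint K r) f = 0 := by
  have h : (Polynomial.evalRingHom (0 : K)).comp (toLine K r) = eval (basePoint K r) := by
    refine MvPolynomial.ringHom_ext (fun a => ?_) fun i => ?_
    · simp [toLine, Polynomial.algebraMap_eq]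
    · simp [toLine_X]
  rw [Polynomial.X_dvd_iff, Polynomial.coeff_zero_eq_eval_zero, ← h]
  rfl

theorem basePoint_succ (i : Fin (r + 2)) :
    basePoint K r i.succ = if i.val < 2 then 0 else (i.val : K) + 1 := by
  simp only [basePoint, Fin.val_succ, Nat.cast_add, Nat.cast_one]
  split_ifs <;> first | rfl | omega

variable [CharZero K]

theorem isShiTriple : IsShiTriple (X 1 : MvPolynomial (Fin (r + 3)) K) (X 2) (X 0) (toLine K r)
    Polynomial.X := by
  have hmod : 2 % (r + 3) = 2 := Nat.mod_eq_of_lt (by omega)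
  have h10 : (1 : Fin (r + 3)) ≠ 0 := by simp
  have h20 : (2 : Fin (r + 3)) ≠ 0 := by simp [Fin.ext_iff, hmod]
  have h21 : (2 : Fin (r + 3)) ≠ 1 := by simp [Fin.ext_iff, hmod]
  let π : Fin (r + 3) → Module.Dual K (Fin (r + 3) → K) := fun i => LinearMap.proj i
  have hπ : ∀ i, formPoly (π i) = X i := formPoly_proj
  have prime : ∀ (α : Module.Dual K (Fin (r + 3) → K)) (v : Fin (r + 3) → K),
      α v ≠ 0 → Prime (formPoly α) := fun α v hv => prime_formPoly fun h => hv (by rw [h]; rfl)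
  have p0 := prime (π 0) 1 (by simp [π])
  have p1 := prime (π 1) 1 (by simp [π])
  have p2 := prime (π 2) 1 (by simp [π])
  have p10 := prime (π 1 - π 0) (Pi.single 1 1) (by simp [π, h10.symm])
  have p20 := prime (π 2 - π 0) (Pi.single 2 1) (by simp [π, h20.symm])
  have p12 := prime (π 1 - π 2) (Pi.single 1 1) (by simp [π, h21])
  have p120 := prime (π 1 - π 2 - π 0) (Pi.single 1 1) (by simp [π, h21, h10.symm])
  have n1 : ¬ formPoly (π 1) ∣ X 2 - X 0 :=
    not_formPoly_dvd (Pi.single 2 1) (by simp [π, h21.symm]) (by simp [h20.symm])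
  have n2 : ¬ formPoly (π 2) ∣ X 1 :=
    not_formPoly_dvd (Pi.single 1 1) (by simp [π, h21]) (by simp)
  have n3 : ¬ formPoly (π 2) ∣ X 1 - X 0 :=
    not_formPoly_dvd (Pi.single 1 1) (by simp [π, h21]) (by simp [h10.symm])
  have n4 : ¬ formPoly (π 0) ∣ X 1 :=
    not_formPoly_dvd (Pi.single 1 1) (by simp [π, h10.symm]) (by simp)
  have n5 : ¬ formPoly (π 0) ∣ X 2 :=
    not_formPoly_dvd (Pi.single 2 1) (by simp [π, h20.symm]) (by simp)
  have n6 : ¬ formPoly (π 0) ∣ X 1 - X 2 :=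
    not_formPoly_dvd (Pi.single 1 1) (by simp [π, h10.symm]) (by simp [h21])
  have n7 : ¬ formPoly (π 1 - π 0) ∣ X 0 :=
    not_formPoly_dvd (Pi.single 0 1 + Pi.single 1 1) (by simp [π, h10, h10.symm])
      (by simp [h10.symm])
  have n8 : ¬ formPoly (π 2 - π 0) ∣ X 0 :=
    not_formPoly_dvd (Pi.single 0 1 + Pi.single 2 1) (by simp [π, h20, h20.symm])
      (by simp [h20.symm])
  have n9 : ¬ formPoly (π 2 - π 0) ∣ X 1 - X 0 :=
    not_formPoly_dvd (Pi.single 1 1) (by simp [π, h21, h10.symm]) (by simp [h10.symm])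
  have n10 : ¬ formPoly (π 1 - π 2) ∣ X 2 :=
    not_formPoly_dvd (Pi.single 1 1 + Pi.single 2 1) (by simp [π, h21, h21.symm])
      (by simp [h21])
  have n11 : ¬ formPoly (π 1 - π 2 - π 0) ∣ X 2 :=
    not_formPoly_dvd (Pi.single 1 1 + Pi.single 2 1)
      (by simp [π, h21, h21.symm, h10.symm, h20.symm]) (by simp [h21])
  have n12 : ¬ formPoly (π 1 - π 2 - π 0) ∣ X 0 :=
    not_formPoly_dvd (Pi.single 0 1 + Pi.single 1 1)
      (by simp [π, h10, h21, h10.symm, h20]) (by simp [h10.symm])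
  simp only [formPoly_sub, hπ] at p0 p1 p2 p10 p20 p12 p120 n1 n2 n3 n4 n5 n6 n7 n8 n9 n10 n11 n12
  refine ⟨p1, p2, p0, p10, p20, p12, p120, n1, n2, n3, n4, n5, n6, n7, n8, n9, n10, n11, n12,
    fun a b c h => ?_, fun b hb => ?_, ?_, ?_, ?_⟩
  -- Differentiating the relation and evaluating where x, y, z all vanish isolates one coefficient
  -- at a time.
  · have key : ∀ i, eval (basePoint K r) (pderiv i (X 1 * a + X 2 * b + X 0 * c)) = 0 :=
      fun i => by rw [h, map_zero, map_zero]
    simp only [X_dvd_toLine_iff]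
    simp only [map_add, pderiv_mul, pderiv_X, map_mul, eval_X] at key
    refine ⟨?_, ?_, ?_⟩
    · simpa [basePoint_eq_zero, h10, h20, h21, h21.symm, h10.symm] using key 1
    · simpa [basePoint_eq_zero, h10, h20, h21, h21.symm, h20.symm] using key 2
    · simpa [basePoint_eq_zero, h10, h20, h10.symm, h20.symm] using key 0
  · rw [Polynomial.X_dvd_iff] at hb ⊢
    simpa using hb
  · simp [toLine_X, basePoint_eq_zero, direction_eq]
  · simp [toLine_X, basePoint_eq_zero, direction_eq, mul_comm Polynomial.X]
    exact map_ofNat Polynomial.C 2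
  · simp [toLine_X, basePoint_eq_zero, direction_eq]

theorem basePoint_succ_eq_zero_iff (i : Fin (r + 2)) : basePoint K r i.succ = 0 ↔ i.val < 2 := by
  rw [basePoint_succ]
  split_ifs with h
  · simp [h]
  · simpa [h] using Nat.cast_add_one_ne_zero i.val

theorem basePoint_succ_eq_iff {i j : Fin (r + 2)} (hij : i < j) :
    basePoint K r i.succ = basePoint K r j.succ ↔ i = 0 ∧ j = 1 := by
  have hij' : i.val < j.val := hij
  have h01 : (i = 0 ∧ j = 1) ↔ j.val < 2 := by
    simp only [Fin.ext_iff, Fin.val_zero, Fin.val_one]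
    omega
  rw [h01]
  by_cases hj : j.val < 2
  · simp [basePoint_succ, hj, hij'.trans hj]
  · simp only [basePoint_succ, hj, if_false, iff_false]
    split_ifs with hi
    · exact (Nat.cast_add_one_ne_zero _).symm
    · exact fun h => hij'.ne (Nat.cast_injective (add_right_cancel h))

theorem shiForm_direction_ne_zero (s : ShiIndex (r + 2))
    (hs : shiForm K (r + 2) s (basePoint K r) = 0) :
    shiForm K (r + 2) s (direction K r) ≠ 0 := by
  have hz := (basePoint_eq_zero K r).1
  have h01 : ∀ i : Fin (r + 2), i.val < 2 → i = 0 ∨ i = 1 := fun i hi => by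
    simp only [Fin.ext_iff, Fin.val_zero, Fin.val_one]
    omega
  rcases s with s | i | i | ⟨⟨i, j⟩, hij⟩ | ⟨⟨i, j⟩, hij⟩ <;>
    simp only [shiForm, Sum.elim_inl, Sum.elim_inr, LinearMap.sub_apply, LinearMap.proj_apply, hz,
      sub_zero, sub_eq_zero, basePoint_succ_eq_zero_iff] at hs ⊢
  · simp [direction_eq]
  · rcases h01 i hs with rfl | rfl <;> simp [direction_eq]
  · rcases h01 i hs with rfl | rfl <;> norm_num [direction_eq]
  · obtain ⟨rfl, rfl⟩ := (basePoint_succ_eq_iff K r hij).1 hs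
    norm_num [direction_eq]
  · obtain ⟨rfl, rfl⟩ := (basePoint_succ_eq_iff K r hij).1 hs
    norm_num [direction_eq]

/-- The coordinates from index 3 on are distinct nonzero integers in K, so only z, x_1, x_2, x_1 -
z, x_2 - z, x_1 - x_2 and x_1 - x_2 - z vanish. -/
theorem sum_shiForm_basePoint [DecidableEq K] : ∑ s : ShiIndex (r + 2),
    (if shiForm K (r + 2) s (basePoint K r) = 0 then 1 else 0) = 7 := by
  have hz := (basePoint_eq_zero K r).1
  have hpair : ∑ p : {p : Fin (r + 2) × Fin (r + 2) // p.1 < p.2},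
      (if basePoint K r p.1.1.succ = basePoint K r p.1.2.succ then 1 else 0) = 1 := by
    rw [Finset.sum_eq_single ⟨(0, 1), by simp⟩]
    · simp [basePoint_eq_zero]
    · rintro ⟨⟨i, j⟩, hij⟩ - hne
      rw [if_neg]
      intro h
      obtain ⟨rfl, rfl⟩ := (basePoint_succ_eq_iff K r hij).1 h
      exact hne rfl
    · simp
  have hsingle : ∑ i : Fin (r + 2), (if i.val < 2 then 1 else 0) = 2 := by
    rw [Fin.sum_univ_succ, Fin.sum_univ_succ]
    simp
  simp only [Fintype.sum_sum_type, shiForm, Sum.elim_inl, Sum.elim_inr, LinearMap.sub_apply,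
    LinearMap.proj_apply, hz, sub_zero, sub_eq_zero, basePoint_succ_eq_zero_iff, hpair, hsingle]
  simp

/-- Each of the seven forms through the point restricts to a nonzero constant times t, every other
form to a polynomial with nonzero constant term. -/
theorem not_X_pow_dvd_toLine (n : ℕ) :
    ¬ (Polynomial.X : Polynomial K) ^ (7 * n + 1) ∣
      toLine K r ((∏ s, formPoly (shiForm K (r + 2) s)) ^ n) := by
  classical
  have hs : ∀ s : ShiIndex (r + 2), ∃ g : Polynomial K, g.eval 0 ≠ 0 ∧
      toLine K r (formPoly (shiForm K (r + 2) s)) =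
        Polynomial.X ^ (if shiForm K (r + 2) s (basePoint K r) = 0 then 1 else 0) * g := by
    intro s
    rw [toLine_formPoly]
    split_ifs with h
    · exact ⟨Polynomial.C (shiForm K (r + 2) s (direction K r)),
        by simpa using shiForm_direction_ne_zero K r s h, by simp [h]⟩
    · exact ⟨Polynomial.C (shiForm K (r + 2) s (basePoint K r)) + Polynomial.X *
        Polynomial.C (shiForm K (r + 2) s (direction K r)), by simpa using h,
        by rw [pow_zero, one_mul]⟩
  choose g hg0 hg using hs
  rw [map_pow, map_prod, Finset.prod_congr rfl fun s _ => hg s, Finset.prod_mul_distrib,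
    Finset.prod_pow_eq_pow_sum, sum_shiForm_basePoint, mul_pow, ← pow_mul, pow_succ]
  intro h
  have h' := Polynomial.X_dvd_iff.1 ((mul_dvd_mul_iff_left (pow_ne_zero _ Polynomial.X_ne_zero)).1 h)
  rw [Polynomial.coeff_zero_eq_eval_zero, Polynomial.eval_pow, Polynomial.eval_prod] at h'
  exact pow_ne_zero n (Finset.prod_ne_zero_iff.2 fun s _ => hg0 s) h'

end Line

/-! ### Counting orders of vanishing -/

section Weights

variable {r : ℕ}

/-- The order of vanishing of the coordinates of an operator along the line. -/
def weight (e : Sym2 (Fin (r + 3))) : ℕ :=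
  -- The exponents 1, 3, 3 of the indices 0, 1, 2 are added over the distinct members of e; the
  -- remaining terms correct the 3 × 3 block to 2 at (0, 0) and 4 elsewhere.
  (if 0 ∈ e then 1 else 0) + (if 1 ∈ e then 3 else 0) + (if 2 ∈ e then 3 else 0) +
    (if e = s(0, 0) then 1 else 0) + (if e = s(1, 1) then 1 else 0) +
    (if e = s(2, 2) then 1 else 0) - (if e = s(1, 2) then 2 else 0)

theorem sum_weight : ∑ e : Sym2 (Fin (r + 3)), weight e = 7 * (r + 3) + 1 := by
  have hmod : 2 % (r + 3) = 2 := Nat.mod_eq_of_lt (by omega)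
  have h21 : (2 : Fin (r + 3)) ≠ 1 := by simp [Fin.ext_iff, hmod]
  have h : ∀ e : Sym2 (Fin (r + 3)), weight e + (if e = s(1, 2) then 2 else 0) =
      (if 0 ∈ e then 1 else 0) + (if 1 ∈ e then 3 else 0) + (if 2 ∈ e then 3 else 0) +
      (if e = s(0, 0) then 1 else 0) + (if e = s(1, 1) then 1 else 0) +
      (if e = s(2, 2) then 1 else 0) := by
    intro e
    rw [weight]
    by_cases he : e = s(1, 2)
    · subst he; simp; omega
    · simp [he]
  have hsum := Finset.sum_congr (rfl : (Finset.univ : Finset (Sym2 (Fin (r + 3)))) = _)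
    fun e _ => h e
  have hcard : ∀ (i : Fin (r + 3)) (c : ℕ),
      ∑ e : Sym2 (Fin (r + 3)), (if i ∈ e then c else 0) = (r + 3) * c := by
    intro i c
    rw [← Finset.sum_filter, Finset.sum_const, card_filter_mem_sym2, Fintype.card_fin, smul_eq_mul]
  simp only [Finset.sum_add_distrib, hcard, Finset.sum_ite_eq', Finset.mem_univ, if_true] at hsum
  omega

theorem cases_sym2 (e : Sym2 (Fin (r + 3))) : e = s(0, 0) ∨ e = s(0, 1) ∨ e = s(0, 2) ∨
    e = s(1, 1) ∨ e = s(1, 2) ∨ e = s(2, 2) ∨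
    ∃ k, k ≠ 0 ∧ k ≠ 1 ∧ k ≠ 2 ∧ (e = s(0, k) ∨ e = s(1, k) ∨ e = s(2, k) ∨
      ∃ l, l ≠ 0 ∧ l ≠ 1 ∧ l ≠ 2 ∧ e = s(l, k)) := by
  induction e with | _ i j
  have h : ∀ k : Fin (r + 3), k = 0 ∨ k = 1 ∨ k = 2 ∨ (k ≠ 0 ∧ k ≠ 1 ∧ k ≠ 2) := fun k => by tauto
  have hs := fun k l : Fin (r + 3) => Sym2.eq_swap (a := k) (b := l)
  rcases h i with rfl | rfl | rfl | hi <;> rcases h j with rfl | rfl | rfl | hj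
  · simp
  · simp
  · simp
  · exact .inr <| .inr <| .inr <| .inr <| .inr <| .inr ⟨j, hj.1, hj.2.1, hj.2.2, .inl rfl⟩
  · simp [hs 1 0]
  · simp
  · simp
  · exact .inr <| .inr <| .inr <| .inr <| .inr <| .inr ⟨j, hj.1, hj.2.1, hj.2.2, .inr (.inl rfl)⟩
  · simp [hs 2 0]
  · simp [hs 2 1]
  · simp
  · exact .inr <| .inr <| .inr <| .inr <| .inr <| .inr
      ⟨j, hj.1, hj.2.1, hj.2.2, .inr (.inr (.inl rfl))⟩
  · exact .inr <| .inr <| .inr <| .inr <| .inr <| .inr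
      ⟨i, hi.1, hi.2.1, hi.2.2, .inl (hs i 0)⟩
  · exact .inr <| .inr <| .inr <| .inr <| .inr <| .inr
      ⟨i, hi.1, hi.2.1, hi.2.2, .inr (.inl (hs i 1))⟩
  · exact .inr <| .inr <| .inr <| .inr <| .inr <| .inr
      ⟨i, hi.1, hi.2.1, hi.2.2, .inr (.inr (.inl (hs i 2)))⟩
  · exact .inr <| .inr <| .inr <| .inr <| .inr <| .inr
      ⟨j, hj.1, hj.2.1, hj.2.2, .inr (.inr (.inr ⟨i, hi.1, hi.2.1, hi.2.2, rfl⟩))⟩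

theorem dvd_det_of_dvd_columns {A ι : Type*} [CommRing A] [Fintype ι] [DecidableEq ι] (v : ι → A)
    (w : Matrix ι ι A) (h : ∀ i j, v j ∣ w i j) : ∏ j, v j ∣ w.det := by
  choose u hu using h
  have : w = Matrix.of fun i j => v j * Matrix.of u i j := by
    ext i j; exact hu i j
  rw [this, Matrix.det_mul_row]
  exact Dvd.intro _ rfl

theorem symCongr_one_sub_vecMulVec {A m : Type*} [CommRing A] [Fintype m] [DecidableEq m]
    (u : m → A) (i₀ : m) (F : Sym2 m → A) (i j : m) :
    symCongr (1 - Matrix.vecMulVec u (Pi.single i₀ 1)) F s(i, j) =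
      F s(i, j) - u j * F s(i, i₀) - u i * F s(i₀, j) + u i * u j * F s(i₀, i₀) := by
  rw [symCongr_mk]
  simp only [Matrix.sub_apply, Matrix.one_apply, Matrix.vecMulVec_apply, Pi.single_apply, sub_mul,
    mul_sub, Finset.sum_sub_distrib, ite_mul, mul_ite, one_mul, zero_mul, mul_one, mul_zero,
    Finset.sum_ite_eq, Finset.sum_ite_eq', Finset.mem_univ, if_true]
  ring

end Weights

/-! ### Excess vanishing of the determinant and the contradiction -/

section NotFree

variable {K : Type*} [Field K] {r : ℕ}

theorem sum_form_sub {n : ℕ} (F : Sym2 (Fin n) → MvPolynomial (Fin n) K) (j : Fin n)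
    (α β : Module.Dual K (Fin n → K)) :
    ∑ i, C ((α - β) (Pi.single i 1)) * F s(i, j) =
      ∑ i, C (α (Pi.single i 1)) * F s(i, j) - ∑ i, C (β (Pi.single i 1)) * F s(i, j) := by
  simp [sub_mul, Finset.sum_sub_distrib]

theorem sum_form_proj {n : ℕ} (F : Sym2 (Fin n) → MvPolynomial (Fin n) K) (j k : Fin n) :
    ∑ i, C ((LinearMap.proj k : Module.Dual K (Fin n → K)) (Pi.single i 1)) * F s(i, j) =
      F s(k, j) := by
  rw [Finset.sum_eq_single k] <;> simp +contextual [eq_comm]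

/-- The divisibility conditions at the hyperplanes of the subarrangement `Shi_2`. -/
theorem shiDvd_of_forall_dvd {F : Sym2 (Fin (r + 3)) → MvPolynomial (Fin (r + 3)) K}
    (hF : ∀ (s : ShiIndex (r + 2)) (j : Fin (r + 3)), formPoly (shiForm K (r + 2) s) ∣
      ∑ i, C (shiForm K (r + 2) s (Pi.single i 1)) * F s(i, j)) (j : Fin (r + 3)) :
    ShiDvd (X 1) (X 2) (X 0) (F s(0, j)) (F s(1, j)) (F s(2, j)) := by
  have h01 : (0 : Fin (r + 2)) < 1 := by simp
  have hx : (Fin.succ 0 : Fin (r + 3)) = 1 := rfl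
  have hy : (Fin.succ 1 : Fin (r + 3)) = 2 := by simp
  have hz := hF (.inl ()) j
  have hx0 := hF (.inr (.inl 0)) j
  have hx1 := hF (.inr (.inl 1)) j
  have hxz0 := hF (.inr (.inr (.inl 0))) j
  have hxz1 := hF (.inr (.inr (.inl 1))) j
  have hxy := hF (.inr (.inr (.inr (.inl ⟨(0, 1), h01⟩)))) j
  have hxyz := hF (.inr (.inr (.inr (.inr ⟨(0, 1), h01⟩)))) j
  simp only [shiForm, Sum.elim_inl, Sum.elim_inr, formPoly_sub, formPoly_proj, sum_form_sub,
    sum_form_proj, hx, hy] at hz hx0 hx1 hxz0 hxz1 hxy hxyz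
  exact ⟨hz, hx0, hx1, hxz0, hxz1, hxy, hxyz⟩

variable [CharZero K]

/-- The direction without its first coordinate, as constant polynomials. -/
def shear (K : Type*) [Field K] (r : ℕ) : Fin (r + 3) → Polynomial K := fun i =>
  if i = 1 then -1 else if i = 2 then 2 else 0

theorem X_pow_weight_dvd {F : Sym2 (Fin (r + 3)) → MvPolynomial (Fin (r + 3)) K}
    (hF : ∀ (s : ShiIndex (r + 2)) (j : Fin (r + 3)), formPoly (shiForm K (r + 2) s) ∣
      ∑ i, C (shiForm K (r + 2) s (Pi.single i 1)) * F s(i, j)) (e : Sym2 (Fin (r + 3))) :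
    (Polynomial.X : Polynomial K) ^ weight e ∣
      symCongr (1 - Matrix.vecMulVec (shear K r) (Pi.single 0 1)) (fun e => toLine K r (F e)) e := by
  have hmod : 2 % (r + 3) = 2 := Nat.mod_eq_of_lt (by omega)
  have h10 : (1 : Fin (r + 3)) ≠ 0 := by simp
  have h20 : (2 : Fin (r + 3)) ≠ 0 := by simp [Fin.ext_iff, hmod]
  have h21 : (2 : Fin (r + 3)) ≠ 1 := by simp [Fin.ext_iff, hmod]
  have hs := shiDvd_of_forall_dvd hF
  have s0 : shear K r 0 = 0 := by simp [shear, h10.symm, h20.symm]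
  have s1 : shear K r 1 = -1 := by simp [shear]
  have s2 : shear K r 2 = 2 := by simp [shear, h21]
  have hu₁ := hs 1
  have hu₂ := hs 2
  rw [Sym2.eq_swap (a := 0) (b := 1), Sym2.eq_swap (a := 2)] at hu₁
  rw [Sym2.eq_swap (a := 0) (b := 2)] at hu₂
  have hu₀ := hs 0
  obtain ⟨d00, d01, d02, d11, d12, d22⟩ := hu₀.map_dvd_of_symm hu₁ hu₂ (isShiTriple K r)
  have hne := And.intro (And.intro h10 h10.symm) (And.intro (And.intro h20 h20.symm)
    (And.intro h21 h21.symm))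
  have w00 : weight (s(0, 0) : Sym2 (Fin (r + 3))) = 2 := by
    simp [weight, hne]
  have w01 : weight (s(0, 1) : Sym2 (Fin (r + 3))) = 4 := by
    simp [weight, hne]
  have w02 : weight (s(0, 2) : Sym2 (Fin (r + 3))) = 4 := by
    simp [weight, hne]
  have w11 : weight (s(1, 1) : Sym2 (Fin (r + 3))) = 4 := by
    simp [weight, hne]
  have w12 : weight (s(1, 2) : Sym2 (Fin (r + 3))) = 4 := by
    simp [weight, hne]
  have w22 : weight (s(2, 2) : Sym2 (Fin (r + 3))) = 4 := by
    simp [weight, hne]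
  have hsw := fun k l : Fin (r + 3) => Sym2.eq_swap (a := k) (b := l)
  rcases cases_sym2 e with rfl | rfl | rfl | rfl | rfl | rfl | ⟨k, k0, k1, k2, h⟩
  · rw [w00, symCongr_one_sub_vecMulVec, s0]
    convert d00 using 1; ring
  · rw [w01, symCongr_one_sub_vecMulVec, s0, s1, hsw 0 1]
    convert d01 using 1; ring
  · rw [w02, symCongr_one_sub_vecMulVec, s0, s2, hsw 0 2]
    convert d02 using 1; ring
  · rw [w11, symCongr_one_sub_vecMulVec, s1, hsw 0 1]
    convert d11 using 1; ring
  · rw [w12, symCongr_one_sub_vecMulVec, s1, s2, hsw 0 2]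
    convert d12 using 1; ring
  · rw [w22, symCongr_one_sub_vecMulVec, s2, hsw 0 2]
    convert d22 using 1; ring
  · have sk : shear K r k = 0 := by simp [shear, k1, k2]
    have hk := And.intro (And.intro k0 k0.symm) (And.intro (And.intro k1 k1.symm)
      (And.intro k2 k2.symm))
    obtain ⟨d0, d1, d2⟩ := (hs k).map_dvd (isShiTriple K r)
    rcases h with rfl | rfl | rfl | ⟨l, l0, l1, l2, rfl⟩
    · have w : weight s(0, k) = 1 := by
        simp [weight, hne, hk]
      rw [w, symCongr_one_sub_vecMulVec, s0, sk]
      convert d0 using 1 <;> ring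
    · have w : weight s(1, k) = 3 := by
        simp [weight, hne, hk]
      rw [w, symCongr_one_sub_vecMulVec, s1, sk]
      convert d1 using 1; ring
    · have w : weight s(2, k) = 3 := by
        simp [weight, hne, hk]
      rw [w, symCongr_one_sub_vecMulVec, s2, sk]
      convert d2 using 1; ring
    · have hl := And.intro (And.intro l0 l0.symm) (And.intro (And.intro l1 l1.symm)
        (And.intro l2 l2.symm))
      have w : weight s(l, k) = 0 := by
        simp [weight, hk, hl]
      rw [w, pow_zero]
      exact one_dvd _

/-- The determinant of a tuple of operators vanishes to order `7 n + 1` along the line. -/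
theorem X_pow_dvd_toLine_det
    {b : Sym2 (Fin (r + 3)) → Sym2 (Fin (r + 3)) → MvPolynomial (Fin (r + 3)) K}
    (hb : ∀ e, ∀ (s : ShiIndex (r + 2)) (j : Fin (r + 3)), formPoly (shiForm K (r + 2) s) ∣
      ∑ i, C (shiForm K (r + 2) s (Pi.single i 1)) * b e s(i, j)) :
    (Polynomial.X : Polynomial K) ^ (7 * (r + 3) + 1) ∣ toLine K r (Matrix.of b).det := by
  have h10 : (1 : Fin (r + 3)) ≠ 0 := by simp
  have h20 : (2 : Fin (r + 3)) ≠ 0 := by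
    have hmod : 2 % (r + 3) = 2 := Nat.mod_eq_of_lt (by omega)
    simp [Fin.ext_iff, hmod]
  let V : Matrix (Fin (r + 3)) (Fin (r + 3)) (Polynomial K) := Matrix.vecMulVec (shear K r) (Pi.single 0 1)
  have hHG : (1 + V) * (1 - V) = 1 :=
    one_add_vecMulVec_mul (by simp [shear, h10.symm, h20.symm])
  -- The congruence by 1 - V is invertible, so the orders found entrywise after the shear bound the
  -- order of the original determinant.
  have hmap : toLine K r (Matrix.of b).det =
      LinearMap.det (symCongr (1 + V)) *
        (Matrix.of fun e => symCongr (1 - V) fun e' => toLine K r (b e e')).det := by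
    rw [← det_symCongr_rows, RingHom.map_det]
    congr 1
    ext e e'
    rw [Matrix.of_apply, symCongr_symCongr hHG]
    rfl
  rw [hmap, ← sum_weight, ← Finset.prod_pow_eq_pow_sum]
  exact (dvd_det_of_dvd_columns _ _ fun e e' => X_pow_weight_dvd (hb e) e').mul_left _

theorem not_isMFree_two_shi (K : Type*) [Field K] [CharZero K] (r : ℕ) :
    ¬ (shi K (r + 2)).IsMFree 2 := by
  intro hfree
  rw [Arrangement.IsMFree, diffOps_shi, ← prod_formPoly_shiForm] at hfree
  obtain ⟨b, hb, hdvd⟩ := exists_rows_det_dvd_pow (shiForm K (r + 2)) (shiForm_ne_zero K _)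
    (shiForm_ker_injective K _)
  exact not_X_pow_dvd_toLine K r (r + 3)
    ((X_pow_dvd_toLine_det hb).trans (map_dvd (toLine K r) hdvd))

end NotFree

end HypArr
end

theorem theorem1p6 {K : Type*} [Field K] [CharZero K] (ℓ : ℕ) (hℓ : 2 ≤ ℓ) :
    ¬ (HypArr.shi K ℓ).IsMFree 2 := by
  obtain ⟨r, rfl⟩ := Nat.exists_eq_add_of_le' hℓ
  exact HypArr.not_isMFree_two_shi K r
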